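/- Let $\pi\colon E\to M$ be a smooth fibre bundle with $\dim M=m$ and fibre dimension $n$, let $\eta$ be a volume form on $M$, let $\pi^1\colon J^1\pi\to E$ be the first-order jet bundle, $\bar\pi^1=\pi\circ\pi^1\colon J^1\pi\to M$ and $\omega=\bar\pi^{1*}\eta$. Let $L\in C^\infty(J^1\pi)$, let $\mathcal L=L\,\omega$ be the associated Lagrangian density, let $\mathcal V$ be the vertical endomorphism of $J^1\pi$, a section of $T^*J^1\pi\otimes V(\pi^1)\otimes \bar\pi^{1*}TM$, given in natural coordinates $(x^\alpha,y^A,v^A_\alpha)$ by $\mathcal V=(dy^A-v^A_\alpha dx^\alpha)\otimes\partial/\partial v^A_\nu\otimes\partial/\partial x^\nu$, and let $$\Theta_{\mathcal L}=i(\mathcal V)\mathcal L+\mathcal L,\qquad \Omega_{\mathcal L}=-d\Theta_{\mathcal L}$$ be the Poincaré–Cartan forms; in natural coordinates with $\omega=d^mx=dx^1\wedge\dots\wedge dx^m$, $$\Theta_{\mathcal L}=\frac{\partial L}{\partial v^A_\alpha}\,(dy^A-v^A_\nu dx^\nu)\wedge i\Big(\frac{\partial}{\partial x^\alpha}\Big)d^mx+L\,d^mx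 .$$ Suppose that the Lagrangian system $(J^1\pi,\Omega_{\mathcal L})$ is regular: $\Omega_{\mathcal L}$ is $1$-nondegenerate (at every point, $i(Z)\Omega_{\mathcal L}=0$ implies $Z=0$), or the matrix $\big(\partial^2L/\partial v^A_\alpha\partial v^B_\nu\big)$ is nonsingular at every point of $J^1\pi$ in natural coordinates. (The first condition implies the second, and they are equivalent if $m\ge 2$ and $n\ge 1$.) Let $\mathcal X_{\mathcal L}$ be an $m$-vector field on $J^1\pi$ which is locally decomposable, that is, every point of $J^1\pi$ has an open neighbourhood on which $\mathcal X_{\mathcal L}=Y_1\wedge\dots\wedge Y_m$ for some smooth vector fields $Y_1,\dots,Y_m$, and suppose that $$i(\mathcal X_{\mathcal L})\omega=1,\qquad i(\mathcal X_{\mathcal L})\Omega_{\mathcal L}=0 .$$ Then $\mathcal X_{\mathcal L}$ is semi-holonomic, that is, $i(\mathcal X_{\mathcal L})\mathcal V=0$, where $\mathcal X_{\mathcal L}$ is contracted with the $T^*J^1\pi$ factor of $\mathcal V$. Consequently $\mathcal X_{\mathcal L}$ is an Euler–Lagrange $m$-vector field for $\mathcal L$, that is, a semi-holonomic locally decomposable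 $m$-vector field with $i(\mathcal X_{\mathcal L})\Omega_{\mathcal L}=0$. -/

import Mathlib

open Set Topology Manifold
open scoped ContDiff

noncomputable section

set_option linter.unusedSectionVars false

/-- The Euclidean space `ℝⁿ`, model space of `n`-dimensional manifolds. -/
abbrev Eu (n : ℕ) : Type := EuclideanSpace ℝ (Fin n)

/-- A smooth fibre bundle `π : E → M` with typical fibre `F`, where `dim M = m`, `dim F = n`. -/
structure SmoothFibreBundle (m n : ℕ) (M F E : Type*)
    [TopologicalSpace M] [ChartedSpace (Eu m) M]
    [TopologicalSpace F] [ChartedSpace (Eu n) F]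
    [TopologicalSpace E] [ChartedSpace (Eu (m + n)) E] where
  /-- the projection `π` -/
  proj : E → M
  /-- `π` is locally trivial: the trivialisations are diffeomorphisms `π⁻¹(U) ≅ U × F` over `U` -/
  exists_trivialization : ∀ x : M, ∃ e : Bundle.Trivialization F proj, x ∈ e.baseSet ∧
    ContMDiffOn (𝓡 (m + n)) ((𝓡 m).prod (𝓡 n)) ∞ e e.source ∧
    ContMDiffOn ((𝓡 m).prod (𝓡 n)) (𝓡 (m + n)) ∞ e.toOpenPartialHomeomorph.symm e.target

section Forms

variable {V : Type*} [NormedAddCommGroup V] [NormedSpace ℝ V]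
  {N : Type*} [TopologicalSpace N] [ChartedSpace V N]

/-- The coordinate expression of a `k`-form `α` on `N` in the preferred chart `φ` at `p`, that is,
the pullback `(φ⁻¹)^* α`. -/
def chartForm {k : ℕ} (α : (q : N) → TangentSpace 𝓘(ℝ, V) q [⋀^Fin k]→L[ℝ] ℝ) (p : N) (z : V) :
    V [⋀^Fin k]→L[ℝ] ℝ :=
  (α ((chartAt V p).symm z)).compContinuousLinearMap
    (mfderiv 𝓘(ℝ, V) 𝓘(ℝ, V) (chartAt V p).symm z)

/-- Smoothness of a differential form. -/
def IsSmoothForm {k : ℕ} (α : (q : N) → TangentSpace 𝓘(ℝ, V) q [⋀^Fin k]→L[ℝ] ℝ) : Prop :=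
  ∀ p : N, ContDiffOn ℝ ∞ (chartForm α p) (chartAt V p).target

/-- The exterior derivative of a differential form, computed at `p` in the chart at `p`. -/
def manifoldExtDeriv {k : ℕ} (α : (q : N) → TangentSpace 𝓘(ℝ, V) q [⋀^Fin k]→L[ℝ] ℝ) (p : N) :
    TangentSpace 𝓘(ℝ, V) p [⋀^Fin (k + 1)]→L[ℝ] ℝ :=
  (extDeriv (chartForm α p) (chartAt V p p)).compContinuousLinearMap
    (mfderiv 𝓘(ℝ, V) 𝓘(ℝ, V) (chartAt V p) p)

/-- An `m`-vector field is locally decomposable if it is locally `Y₁ ∧ … ∧ Y_m` for smooth local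
vector fields `Y₁, …, Y_m`. -/
def IsLocallyDecomposable [IsManifold 𝓘(ℝ, V) ∞ N] {m : ℕ}
    (X : (q : N) → ⋀[ℝ]^m (TangentSpace 𝓘(ℝ, V) q)) : Prop :=
  ∀ p : N, ∃ U : Set N, IsOpen U ∧ p ∈ U ∧
    ∃ Y : Fin m → (q : N) → TangentSpace 𝓘(ℝ, V) q,
      (∀ i, ContMDiffOn 𝓘(ℝ, V) 𝓘(ℝ, V).tangent ∞
        (fun q => (⟨q, Y i q⟩ : TangentBundle 𝓘(ℝ, V) N)) U) ∧
      ∀ q ∈ U, X q = exteriorPower.ιMulti ℝ m (fun i => Y i q)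

end Forms

section LinearAlgebra

variable {V : Type*} [AddCommGroup V] [Module ℝ V] [TopologicalSpace V]

/-- `i(X)α` for an `m`-vector `X` and an `m`-form `α`;
`i(Y₁ ∧ … ∧ Y_m)α = α(Y₁, …, Y_m)`. -/
def mvPair {m : ℕ} (X : ⋀[ℝ]^m V) (α : V [⋀^Fin m]→L[ℝ] ℝ) : ℝ :=
  exteriorPower.alternatingMapLinearEquiv α.toAlternatingMap X

/-- `i(X)Ω` for an `m`-vector `X` and an `(m+1)`-form `Ω`; it is the `1`-form with
`[i(Y₁ ∧ … ∧ Y_m)Ω](w) = Ω(Y₁, …, Y_m, w) = (-1)^m Ω(w, Y₁, …, Y_m)`. -/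
def mvContract {m : ℕ} (X : ⋀[ℝ]^m V) (Ω : V [⋀^Fin (m + 1)]→L[ℝ] ℝ) : V →ₗ[ℝ] ℝ :=
  (-1 : ℝ) ^ m • (LinearMap.applyₗ X ∘ₗ
    (exteriorPower.alternatingMapLinearEquiv (R := ℝ) (M := V) (N := ℝ) (n := m)).toLinearMap ∘ₗ
      Ω.toAlternatingMap.curryLeft)

/-- A form `Ω` of positive degree is `1`-nondegenerate if `i(Z)Ω = 0` only for `Z = 0`. -/
def IsOneNondegenerate {m : ℕ} (Ω : V [⋀^Fin (m + 1)]→L[ℝ] ℝ) : Prop :=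
  ∀ Z : V, (∀ w : Fin m → V, Ω (Fin.cons Z w) = 0) → Z = 0

variable {W : Type*} [AddCommGroup W] [Module ℝ W] [TopologicalSpace W]

theorem tensorContract_aux {m : ℕ} (P T : V →L[ℝ] W) (Z : Fin m → V) (i k : Fin m) (x : V) :
    Function.update (fun j => T (Function.update Z i x j)) k (P (Function.update Z i x k)) =
      Function.update (Function.update (fun j => T (Z j)) i (T x)) k
        (P (Function.update Z i x k)) := by
  congr 1
  funext j
  rcases eq_or_ne j i with rfl | h
  · simp
  · simp [h]

/-- The contraction `i(P)η` of a tensor `P = ∑ a ⊗ w ∈ V^* ⊗ W`, seen as a linear map `P : V → W`,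
with the pullback by `T : V → W` of an `m`-form `η` on `W`: it is `∑ a ∧ T^* i(w)η`, that is,
`(Z₁, …, Z_m) ↦ ∑ᵢ η(T Z₁, …, P Zᵢ, …, T Z_m)` (with `P Zᵢ` in the `i`-th position). -/
def tensorContract {m : ℕ} (P T : V →L[ℝ] W) (η : W [⋀^Fin m]→L[ℝ] ℝ) :
    V [⋀^Fin m]→L[ℝ] ℝ where
  toFun Z := ∑ i, η (Function.update (fun j => T (Z j)) i (P (Z i)))
  map_update_add' {inst} Z i x y := by
    obtain rfl : inst = instDecidableEqFin m := Subsingleton.elim _ _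
    rw [← Finset.sum_add_distrib]
    refine Finset.sum_congr rfl fun k _ => ?_
    rw [tensorContract_aux, tensorContract_aux, tensorContract_aux]
    rcases eq_or_ne k i with rfl | h
    · simp
    · simp only [Function.update_comm h.symm, Function.update_of_ne h]
      rw [map_add, η.map_update_add]
  map_update_smul' {inst} Z i c x := by
    obtain rfl : inst = instDecidableEqFin m := Subsingleton.elim _ _
    rw [Finset.smul_sum]
    refine Finset.sum_congr rfl fun k _ => ?_
    rw [tensorContract_aux, tensorContract_aux]
    rcases eq_or_ne k i with rfl | h
    · simp
    · simp only [Function.update_comm h.symm, Function.update_of_ne h]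
      rw [map_smul, η.map_update_smul]
  map_eq_zero_of_eq' Z i k hik hne := by
    rw [Fintype.sum_eq_add i k hne]
    · rw [← hik]
      have h : Function.update (fun j => T (Z j)) k (P (Z i)) =
          Function.update (fun j => T (Z j)) i (P (Z i)) ∘ Equiv.swap i k := by
        funext l
        rcases eq_or_ne l i with rfl | hli
        · simp [hne, hne.symm, hik]
        · rcases eq_or_ne l k with rfl | hlk
          · simp
          · simp [hli, hlk, Equiv.swap_apply_of_ne_of_ne]
      rw [h]
      have h2 := η.toAlternatingMap.map_swap (Function.update (fun j => T (Z j)) i (P (Z i))) hne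
      have h3 : η (Function.update (fun j => T (Z j)) i (P (Z i)) ∘ Equiv.swap i k) =
        - η (Function.update (fun j => T (Z j)) i (P (Z i))) := h2
      rw [h3, add_neg_cancel]
    · rintro l ⟨hli, hlk⟩
      refine η.map_eq_zero_of_eq _ (i := i) (j := k) ?_ hne
      simp [Function.update_of_ne hli.symm, Function.update_of_ne hlk.symm, hik]
  cont := by
    refine continuous_finsetSum _ fun i _ => η.cont.comp ?_
    exact Continuous.update (by fun_prop) i (by fun_prop)

end LinearAlgebra

namespace SmoothFibreBundle

variable {m n : ℕ} {M F E : Type*}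
  [TopologicalSpace M] [ChartedSpace (Eu m) M] [IsManifold (𝓡 m) ∞ M]
  [TopologicalSpace F] [ChartedSpace (Eu n) F] [IsManifold (𝓡 n) ∞ F]
  [TopologicalSpace E] [ChartedSpace (Eu (m + n)) E] [IsManifold (𝓡 (m + n)) ∞ E]
  (B : SmoothFibreBundle m n M F E)

/-- The tangent map `T_y π : T_y E → T_{π(y)} M`. -/
def dproj (y : E) : Eu (m + n) →L[ℝ] Eu m := mfderiv (𝓡 (m + n)) (𝓡 m) B.proj y

/-- Fibred coordinates `(x^α, y^A)` on an open subset of `E`, over coordinates `(x^α)` on an open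
subset of `M`. -/
structure FibredChart where
  base : OpenPartialHomeomorph M (Eu m)
  total : OpenPartialHomeomorph E (Eu m × Eu n)
  base_smooth : ContMDiffOn (𝓡 m) (𝓡 m) ∞ base base.source
  base_symm_smooth : ContMDiffOn (𝓡 m) (𝓡 m) ∞ base.symm base.target
  total_smooth : ContMDiffOn (𝓡 (m + n)) 𝓘(ℝ, Eu m × Eu n) ∞ total total.source
  total_symm_smooth : ContMDiffOn 𝓘(ℝ, Eu m × Eu n) (𝓡 (m + n)) ∞ total.symm total.target
  proj_mem : ∀ y ∈ total.source, B.proj y ∈ base.source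
  base_proj : ∀ y ∈ total.source, base (B.proj y) = (total y).1

theorem exists_fibredChart (y : E) : ∃ c : B.FibredChart, y ∈ c.total.source := by
  obtain ⟨e, he, hs, hs'⟩ := B.exists_trivialization (B.proj y)
  have hye : y ∈ e.source := by rw [e.source_eq]; exact he
  set φ := chartAt (Eu m) (B.proj y) with hφ
  set ψ := chartAt (Eu n) (e y).2 with hψ
  have hφs : ContMDiffOn (𝓡 m) (𝓡 m) ∞ φ φ.source := contMDiffOn_chart
  have hφs' : ContMDiffOn (𝓡 m) (𝓡 m) ∞ φ.symm φ.target := contMDiffOn_chart_symm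
  have hψs : ContMDiffOn (𝓡 n) (𝓡 n) ∞ ψ ψ.source := contMDiffOn_chart
  have hψs' : ContMDiffOn (𝓡 n) (𝓡 n) ∞ ψ.symm ψ.target := contMDiffOn_chart_symm
  let T : OpenPartialHomeomorph E (Eu m × Eu n) := e.toOpenPartialHomeomorph.trans (φ.prod ψ)
  have hT : ∀ z ∈ T.source, z ∈ e.source ∧ (e z).1 ∈ φ.source ∧ (e z).2 ∈ ψ.source := by
    intro z hz
    rw [OpenPartialHomeomorph.trans_source] at hz
    exact ⟨hz.1, hz.2.1, hz.2.2⟩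
  have hT' : ∀ z ∈ T.target, z.1 ∈ φ.target ∧ z.2 ∈ ψ.target ∧
      (φ.symm z.1, ψ.symm z.2) ∈ e.target := by
    intro z hz
    rw [OpenPartialHomeomorph.trans_target] at hz
    exact ⟨hz.1.1, hz.1.2, hz.2⟩
  refine ⟨⟨φ, T, hφs, hφs', ?_, ?_, ?_, ?_⟩, ?_⟩
  · have h := hs.mono (fun z hz => (hT z hz).1)
    exact (hφs.comp (contMDiff_fst.comp_contMDiffOn h) fun z hz => (hT z hz).2.1).prodMk_space
      (hψs.comp (contMDiff_snd.comp_contMDiffOn h) fun z hz => (hT z hz).2.2)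
  · refine hs'.comp (t := e.target) (f := fun z : Eu m × Eu n => (φ.symm z.1, ψ.symm z.2)) ?_ ?_
    · have h1 : ContMDiffOn 𝓘(ℝ, Eu m × Eu n) (𝓡 m) ∞ (fun z : Eu m × Eu n => z.1) T.target :=
        contDiff_fst.contMDiff.contMDiffOn
      have h2 : ContMDiffOn 𝓘(ℝ, Eu m × Eu n) (𝓡 n) ∞ (fun z : Eu m × Eu n => z.2) T.target :=
        contDiff_snd.contMDiff.contMDiffOn
      exact (hφs'.comp h1 fun z hz => (hT' z hz).1).prodMk
        (hψs'.comp h2 fun z hz => (hT' z hz).2.1)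
    · exact fun z hz => (hT' z hz).2.2
  · intro z hz
    rw [← e.coe_fst (hT z hz).1]
    exact (hT z hz).2.1
  · intro z hz
    rw [← e.coe_fst (hT z hz).1]
    rfl
  · change y ∈ (e.toOpenPartialHomeomorph.trans (φ.prod ψ)).source
    rw [OpenPartialHomeomorph.trans_source]
    refine ⟨hye, ?_, ?_⟩
    · change (e y).1 ∈ φ.source
      rw [e.coe_fst hye]
      exact mem_chart_source _ _
    · exact mem_chart_source _ _

/-- The first-order jet bundle `J¹π`: a point over `y ∈ E` is the tangent map
`T_{π(y)} M → T_y E` at `π(y)` of a local section of `π` through `y`, that is,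
a linear right inverse of `T_y π`. -/
structure J1 where
  /-- the target `y = π¹(j)` -/
  pt : E
  /-- the linear map `T_{π(y)} M → T_y E` -/
  lin : Eu m →L[ℝ] Eu (m + n)
  right_inv : (B.dproj pt).comp lin = ContinuousLinearMap.id ℝ (Eu m)


namespace FibredChart

variable {B} (c c' : B.FibredChart)

/-- Tangent map of the fibred chart of `E`. -/
def dtotal (y : E) : Eu (m + n) →L[ℝ] Eu m × Eu n :=
  mfderiv (𝓡 (m + n)) 𝓘(ℝ, Eu m × Eu n) c.total y

/-- Tangent map of the inverse of the fibred chart of `E`. -/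
def dtotalSymm (z : Eu m × Eu n) : Eu m × Eu n →L[ℝ] Eu (m + n) :=
  mfderiv 𝓘(ℝ, Eu m × Eu n) (𝓡 (m + n)) c.total.symm z

/-- Tangent map of the chart of `M`. -/
def dbase (x : M) : Eu m →L[ℝ] Eu m := mfderiv (𝓡 m) (𝓡 m) c.base x

/-- Tangent map of the inverse of the chart of `M`. -/
def dbaseSymm (u : Eu m) : Eu m →L[ℝ] Eu m := mfderiv (𝓡 m) (𝓡 m) c.base.symm u

theorem total_mdiff : c.total.MDifferentiable (𝓡 (m + n)) 𝓘(ℝ, Eu m × Eu n) :=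
  ⟨c.total_smooth.mdifferentiableOn (by simp), c.total_symm_smooth.mdifferentiableOn (by simp)⟩

theorem base_mdiff : c.base.MDifferentiable (𝓡 m) (𝓡 m) :=
  ⟨c.base_smooth.mdifferentiableOn (by simp), c.base_symm_smooth.mdifferentiableOn (by simp)⟩

theorem dtotalSymm_dtotal {y : E} (hy : y ∈ c.total.source) :
    (c.dtotalSymm (c.total y)).comp (c.dtotal y) = ContinuousLinearMap.id ℝ _ :=
  c.total_mdiff.symm_comp_deriv hy

theorem dtotal_dtotalSymm {z : Eu m × Eu n} (hz : z ∈ c.total.target) :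
    (c.dtotal (c.total.symm z)).comp (c.dtotalSymm z) = ContinuousLinearMap.id ℝ _ :=
  c.total_mdiff.comp_symm_deriv hz

theorem dbaseSymm_dbase {x : M} (hx : x ∈ c.base.source) :
    (c.dbaseSymm (c.base x)).comp (c.dbase x) = ContinuousLinearMap.id ℝ _ :=
  c.base_mdiff.symm_comp_deriv hx

theorem dbase_dbaseSymm {u : Eu m} (hu : u ∈ c.base.target) :
    (c.dbase (c.base.symm u)).comp (c.dbaseSymm u) = ContinuousLinearMap.id ℝ _ :=
  c.base_mdiff.comp_symm_deriv hu

theorem proj_mdifferentiableAt {y : E} (hy : y ∈ c.total.source) :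
    MDifferentiableAt (𝓡 (m + n)) (𝓡 m) B.proj y := by
  have h1 : MDifferentiableAt (𝓡 (m + n)) (𝓡 m) (fun y => c.base.symm (c.total y).1) y := by
    have hf : MDifferentiableAt 𝓘(ℝ, Eu m × Eu n) (𝓡 m) (fun z : Eu m × Eu n => z.1)
        (c.total y) := differentiableAt_fst.mdifferentiableAt
    have hb : MDifferentiableAt (𝓡 m) (𝓡 m) c.base.symm (c.total y).1 := by
      refine c.base_mdiff.mdifferentiableAt_symm ?_
      rw [← c.base_proj y hy]
      exact c.base.map_source (c.proj_mem y hy)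
    exact MDifferentiableAt.comp y hb (hf.comp y (c.total_mdiff.mdifferentiableAt hy))
  refine h1.congr_of_eventuallyEq ?_
  filter_upwards [c.total.open_source.mem_nhds hy] with z hz
  rw [← c.base_proj z hz, c.base.left_inv (c.proj_mem z hz)]

theorem dbase_dproj {y : E} (hy : y ∈ c.total.source) :
    (c.dbase (B.proj y)).comp (B.dproj y) =
      (ContinuousLinearMap.fst ℝ (Eu m) (Eu n)).comp (c.dtotal y) := by
  have h1 := mfderiv_comp y (c.base_mdiff.mdifferentiableAt (c.proj_mem y hy))
    (c.proj_mdifferentiableAt hy)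
  have hf : MDifferentiableAt 𝓘(ℝ, Eu m × Eu n) (𝓡 m) (Prod.fst : Eu m × Eu n → Eu m)
      (c.total y) := differentiableAt_fst.mdifferentiableAt
  have h2 := mfderiv_comp y hf (c.total_mdiff.mdifferentiableAt hy)
  have h3 : (c.base ∘ B.proj) =ᶠ[𝓝 y] (Prod.fst ∘ c.total) := by
    filter_upwards [c.total.open_source.mem_nhds hy] with z hz
    exact c.base_proj z hz
  rw [h3.mfderiv_eq, h2] at h1
  have h4 : mfderiv 𝓘(ℝ, Eu m × Eu n) (𝓡 m) (Prod.fst : Eu m × Eu n → Eu m) (c.total y) =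
      ContinuousLinearMap.fst ℝ (Eu m) (Eu n) := by
    rw [mfderiv_eq_fderiv]
    exact fderiv_fst
  rw [h4] at h1
  exact h1.symm

theorem base_symm_fst {z : Eu m × Eu n} (hz : z ∈ c.total.target) :
    B.proj (c.total.symm z) = c.base.symm z.1 := by
  have hy := c.total.map_target hz
  have h := c.base_proj _ hy
  rw [c.total.right_inv hz] at h
  rw [← h, c.base.left_inv (c.proj_mem _ hy)]

end FibredChart

/-- The model space of `J¹π`, with coordinates `(x^α, y^A, v^A_α)`. -/
abbrev J1Model (m n : ℕ) : Type := Eu m × Eu n × (Eu m →L[ℝ] Eu n)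

namespace FibredChart

variable {B} (c c' : B.FibredChart)

/-- The linear map `∂/∂x^α ↦ ∂/∂x^α + v^A_α ∂/∂y^A` at the point with coordinates `z = (x, y)`. -/
def linOf (z : Eu m × Eu n) (v : Eu m →L[ℝ] Eu n) : Eu m →L[ℝ] Eu (m + n) :=
  ((c.dtotalSymm z).comp ((ContinuousLinearMap.id ℝ (Eu m)).prod v)).comp
    (c.dbase (B.proj (c.total.symm z)))

theorem dproj_linOf {z : Eu m × Eu n} (hz : z ∈ c.total.target) (v : Eu m →L[ℝ] Eu n) :
    (B.dproj (c.total.symm z)).comp (c.linOf z v) = ContinuousLinearMap.id ℝ (Eu m) := by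
  have hy := c.total.map_target hz
  have hx := c.proj_mem _ hy
  ext1 a
  have h1 := fun b => DFunLike.congr_fun (c.dbaseSymm_dbase hx) b
  have h2 := fun b => DFunLike.congr_fun (c.dbase_dproj hy) b
  have h3 := fun b => DFunLike.congr_fun (c.dtotal_dtotalSymm hz) b
  simp only [ContinuousLinearMap.comp_apply, ContinuousLinearMap.id_apply,
    ContinuousLinearMap.coe_fst'] at h1 h2 h3
  simp only [linOf, ContinuousLinearMap.comp_apply, ContinuousLinearMap.id_apply]
  rw [← h1 (B.dproj _ _), h2, h3]
  simp only [ContinuousLinearMap.prod_apply, ContinuousLinearMap.id_apply]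
  exact h1 a

/-- The coordinates `v^A_α` of the jet `j`. -/
def velocity (j : B.J1) : Eu m →L[ℝ] Eu n :=
  ((ContinuousLinearMap.snd ℝ (Eu m) (Eu n)).comp (c.dtotal j.pt)).comp
    (j.lin.comp (c.dbaseSymm (c.total j.pt).1))

theorem linOf_velocity {j : B.J1} (hj : j.pt ∈ c.total.source) :
    c.linOf (c.total j.pt) (c.velocity j) = j.lin := by
  have hx := c.proj_mem _ hj
  have h1 := fun b => DFunLike.congr_fun (c.dbaseSymm_dbase hx) b
  have h2 := fun b => DFunLike.congr_fun (c.dbase_dproj hj) b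
  have h3 := fun b => DFunLike.congr_fun (c.dtotalSymm_dtotal hj) b
  have h4 := fun b => DFunLike.congr_fun j.right_inv b
  simp only [ContinuousLinearMap.comp_apply, ContinuousLinearMap.id_apply,
    ContinuousLinearMap.coe_fst'] at h1 h2 h3 h4
  ext1 a
  simp only [linOf, velocity, ContinuousLinearMap.comp_apply, ContinuousLinearMap.prod_apply,
    ContinuousLinearMap.id_apply, c.total.left_inv hj, ContinuousLinearMap.coe_snd',
    ← c.base_proj _ hj, h1]
  have h5 : (c.dbase (B.proj j.pt) a, (c.dtotal j.pt (j.lin a)).2) = c.dtotal j.pt (j.lin a) :=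
    Prod.ext (by rw [← h2, h4]) rfl
  rw [h5, h3]

theorem velocity_linOf {z : Eu m × Eu n} (hz : z ∈ c.total.target) (v : Eu m →L[ℝ] Eu n) :
    c.velocity ⟨c.total.symm z, c.linOf z v, c.dproj_linOf hz v⟩ = v := by
  have hy := c.total.map_target hz
  have hu : z.1 ∈ c.base.target := by
    have h := c.base.map_source (c.proj_mem _ hy)
    rwa [c.base_proj _ hy, c.total.right_inv hz] at h
  have h3 := fun b => DFunLike.congr_fun (c.dtotal_dtotalSymm hz) b
  have h4 := fun b => DFunLike.congr_fun (c.dbase_dbaseSymm hu) b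
  simp only [ContinuousLinearMap.comp_apply, ContinuousLinearMap.id_apply] at h3 h4
  ext1 a
  simp only [linOf, velocity, ContinuousLinearMap.comp_apply, ContinuousLinearMap.prod_apply,
    ContinuousLinearMap.id_apply, c.total.right_inv hz, ContinuousLinearMap.coe_snd', h3,
    c.base_symm_fst hz, h4]

open Classical in
/-- The natural chart `j ↦ (x^α, y^A, v^A_α)` of `J¹π` induced by a fibred chart
(`j₀` only provides values of the inverse outside of its domain). -/
def natChart (j₀ : B.J1) : PartialEquiv B.J1 (J1Model m n) where
  toFun j := ((c.total j.pt).1, (c.total j.pt).2, c.velocity j)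
  invFun w := if h : (w.1, w.2.1) ∈ c.total.target then
    ⟨c.total.symm (w.1, w.2.1), c.linOf (w.1, w.2.1) w.2.2, c.dproj_linOf h w.2.2⟩ else j₀
  source := {j | j.pt ∈ c.total.source}
  target := {w | (w.1, w.2.1) ∈ c.total.target}
  map_source' j hj := c.total.map_source hj
  map_target' w hw := by
    have hw' : (w.1, w.2.1) ∈ c.total.target := hw
    rw [dif_pos hw']
    exact c.total.map_target hw'
  left_inv' j hj := by
    have h := c.total.map_source hj
    have h' : ((c.total j.pt).1, (c.total j.pt).2) ∈ c.total.target := h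
    rw [dif_pos h']
    have e1 := c.total.left_inv hj
    have e2 := c.linOf_velocity hj
    cases j
    simp only [Prod.mk.eta, J1.mk.injEq]
    exact ⟨e1, e2⟩
  right_inv' w hw := by
    have hw' : (w.1, w.2.1) ∈ c.total.target := hw
    rw [dif_pos hw']
    refine Prod.ext ?_ (Prod.ext ?_ ?_)
    · simp only [c.total.right_inv hw']
    · simp only [c.total.right_inv hw']
    · exact c.velocity_linOf hw' w.2.2

theorem natChart_symm_apply (j₀ : B.J1) {w : J1Model m n} (hw : (w.1, w.2.1) ∈ c.total.target) :
    (c.natChart j₀).symm w =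
      ⟨c.total.symm (w.1, w.2.1), c.linOf (w.1, w.2.1) w.2.2, c.dproj_linOf hw w.2.2⟩ :=
  dif_pos hw

theorem mem_trans_source (j₀ j₁ : B.J1) (w : J1Model m n) :
    w ∈ ((c.natChart j₀).symm.trans (c'.natChart j₁)).source ↔
      (w.1, w.2.1) ∈ (c.total.symm.trans c'.total).source := by
  rw [PartialEquiv.trans_source, OpenPartialHomeomorph.trans_source]
  constructor
  · rintro ⟨h1, h2⟩
    have h1' : (w.1, w.2.1) ∈ c.total.target := h1
    rw [mem_preimage, c.natChart_symm_apply j₀ h1'] at h2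
    exact ⟨h1, h2⟩
  · rintro ⟨h1, h2⟩
    refine ⟨h1, ?_⟩
    have h1' : (w.1, w.2.1) ∈ c.total.target := h1
    rw [mem_preimage, c.natChart_symm_apply j₀ h1']
    exact h2

theorem isOpen_trans_source (j₀ j₁ : B.J1) :
    IsOpen ((c.natChart j₀).symm.trans (c'.natChart j₁)).source := by
  have h : ((c.natChart j₀).symm.trans (c'.natChart j₁)).source =
      (fun w : J1Model m n => (w.1, w.2.1)) ⁻¹' (c.total.symm.trans c'.total).source :=
    Set.ext fun w => c.mem_trans_source c' j₀ j₁ w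
  rw [h]
  exact (c.total.symm.trans c'.total).open_source.preimage (by fun_prop)

theorem total_trans_contDiffOn :
    ContDiffOn ℝ ∞ (c'.total ∘ c.total.symm) (c.total.symm.trans c'.total).source := by
  rw [← contMDiffOn_iff_contDiffOn]
  rw [OpenPartialHomeomorph.trans_source]
  exact c'.total_smooth.comp (c.total_symm_smooth.mono fun z hz => hz.1) fun z hz => hz.2

theorem base_trans_contDiffOn :
    ContDiffOn ℝ ∞ (c'.base ∘ c.base.symm) (c.base.symm.trans c'.base).source := by
  rw [← contMDiffOn_iff_contDiffOn]
  rw [OpenPartialHomeomorph.trans_source]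
  exact c'.base_smooth.comp (c.base_symm_smooth.mono fun z hz => hz.1) fun z hz => hz.2

theorem fderiv_total_trans {z : Eu m × Eu n} (hz : z ∈ (c.total.symm.trans c'.total).source) :
    fderiv ℝ (c'.total ∘ c.total.symm) z =
      (c'.dtotal (c.total.symm z)).comp (c.dtotalSymm z) := by
  rw [OpenPartialHomeomorph.trans_source] at hz
  rw [← mfderiv_eq_fderiv]
  exact mfderiv_comp z (c'.total_mdiff.mdifferentiableAt hz.2)
    (c.total_mdiff.mdifferentiableAt_symm hz.1)

theorem fderiv_base_trans {u : Eu m} (hu : u ∈ (c.base.symm.trans c'.base).source) :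
    fderiv ℝ (c'.base ∘ c.base.symm) u =
      (c'.dbase (c.base.symm u)).comp (c.dbaseSymm u) := by
  rw [OpenPartialHomeomorph.trans_source] at hu
  rw [← mfderiv_eq_fderiv]
  exact mfderiv_comp u (c'.base_mdiff.mdifferentiableAt hu.2)
    (c.base_mdiff.mdifferentiableAt_symm hu.1)

/-- The changes of natural coordinates are smooth. -/
theorem natChart_trans_contDiffOn (j₀ j₁ : B.J1) :
    ContDiffOn ℝ ∞ ((c.natChart j₀).symm.trans (c'.natChart j₁))
      ((c.natChart j₀).symm.trans (c'.natChart j₁)).source := by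
  set S := ((c.natChart j₀).symm.trans (c'.natChart j₁)).source with hS
  set T : Eu m × Eu n → Eu m × Eu n := c'.total ∘ c.total.symm with hT
  set R : Eu m → Eu m := c.base ∘ c'.base.symm with hR
  have hp : ContDiffOn ℝ ∞ (fun w : J1Model m n => (w.1, w.2.1)) S :=
    (contDiff_fst.prodMk (contDiff_fst.comp contDiff_snd)).contDiffOn
  have hmaps : ∀ w ∈ S, (w.1, w.2.1) ∈ (c.total.symm.trans c'.total).source :=
    fun w hw => (c.mem_trans_source c' j₀ j₁ w).1 hw
  have h1 : ContDiffOn ℝ ∞ (fun w : J1Model m n => T (w.1, w.2.1)) S :=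
    (c.total_trans_contDiffOn c').comp hp hmaps
  have h2 : ContDiffOn ℝ ∞ (fun w : J1Model m n => fderiv ℝ T (w.1, w.2.1)) S :=
    ((c.total_trans_contDiffOn c').fderiv_of_isOpen
      (c.total.symm.trans c'.total).open_source (by simp)).comp hp hmaps
  have hmaps' : ∀ w ∈ S, (T (w.1, w.2.1)).1 ∈ (c'.base.symm.trans c.base).source := by
    intro w hw
    have hz := hmaps w hw
    rw [OpenPartialHomeomorph.trans_source] at hz
    have hb := c'.base_proj _ hz.2
    rw [OpenPartialHomeomorph.trans_source]
    have e : (T (w.1, w.2.1)).1 = c'.base (B.proj (c.total.symm (w.1, w.2.1))) := hb.symm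
    rw [e]
    refine ⟨c'.base.map_source (c'.proj_mem _ hz.2), ?_⟩
    rw [mem_preimage, c'.base.left_inv (c'.proj_mem _ hz.2)]
    exact c.proj_mem _ (c.total.map_target hz.1)
  have h3 : ContDiffOn ℝ ∞ (fun w : J1Model m n => fderiv ℝ R (T (w.1, w.2.1)).1) S :=
    ((c'.base_trans_contDiffOn c).fderiv_of_isOpen
      (c'.base.symm.trans c.base).open_source (by simp)).comp
      (contDiff_fst.comp_contDiffOn h1) hmaps'
  have hv : ContDiffOn ℝ ∞
      (fun w : J1Model m n => (ContinuousLinearMap.inl ℝ (Eu m) (Eu n)) +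
        (ContinuousLinearMap.inr ℝ (Eu m) (Eu n)).comp w.2.2) S :=
    (contDiff_const.add (contDiff_const.clm_comp
      (contDiff_snd.comp contDiff_snd))).contDiffOn
  have h4 : ContDiffOn ℝ ∞ (fun w : J1Model m n =>
      (((ContinuousLinearMap.snd ℝ (Eu m) (Eu n)).comp (fderiv ℝ T (w.1, w.2.1))).comp
        ((ContinuousLinearMap.inl ℝ (Eu m) (Eu n)) +
        (ContinuousLinearMap.inr ℝ (Eu m) (Eu n)).comp w.2.2)).comp
        (fderiv ℝ R (T (w.1, w.2.1)).1)) S :=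
    (((contDiffOn_const.clm_comp h2).clm_comp hv).clm_comp h3)
  have h5 : ContDiffOn ℝ ∞ (fun w : J1Model m n => ((T (w.1, w.2.1)).1, (T (w.1, w.2.1)).2,
      (((ContinuousLinearMap.snd ℝ (Eu m) (Eu n)).comp (fderiv ℝ T (w.1, w.2.1))).comp
        ((ContinuousLinearMap.inl ℝ (Eu m) (Eu n)) +
        (ContinuousLinearMap.inr ℝ (Eu m) (Eu n)).comp w.2.2)).comp
        (fderiv ℝ R (T (w.1, w.2.1)).1))) S :=
    (contDiff_fst.comp_contDiffOn h1).prodMk ((contDiff_snd.comp_contDiffOn h1).prodMk h4)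
  refine h5.congr fun w hw => ?_
  have hz := hmaps w hw
  have hz' := hmaps' w hw
  have e2 := c.fderiv_total_trans c' hz
  have e3 := c'.fderiv_base_trans c hz'
  rw [OpenPartialHomeomorph.trans_source] at hz
  have hzt : (w.1, w.2.1) ∈ c.total.target := hz.1
  have e4 : c'.base.symm (T (w.1, w.2.1)).1 = B.proj (c.total.symm (w.1, w.2.1)) := by
    have hb := c'.base_proj _ hz.2
    have e : (T (w.1, w.2.1)).1 = c'.base (B.proj (c.total.symm (w.1, w.2.1))) := hb.symm
    rw [e, c'.base.left_inv (c'.proj_mem _ hz.2)]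
  rw [PartialEquiv.coe_trans, Function.comp_apply, c.natChart_symm_apply j₀ hzt]
  refine Prod.ext rfl (Prod.ext rfl ?_)
  rw [hT, e2, hR, e3, ← hT, e4]
  ext1 a
  simp only [natChart, velocity, linOf, ContinuousLinearMap.comp_apply,
    add_apply, ContinuousLinearMap.prod_apply, ContinuousLinearMap.id_apply,
    ContinuousLinearMap.inl_apply, ContinuousLinearMap.inr_apply, Prod.mk_add_mk, add_zero,
    zero_add]
  rfl

end FibredChart

/-- The atlas of natural charts of `J¹π`. -/
def j1Core : ChartedSpaceCore (J1Model m n) B.J1 where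
  atlas := {e | ∃ (c : B.FibredChart) (j₀ : B.J1), e = c.natChart j₀}
  chartAt j := (B.exists_fibredChart j.pt).choose.natChart j
  mem_chart_source j := (B.exists_fibredChart j.pt).choose_spec
  chart_mem_atlas j := ⟨_, _, rfl⟩
  open_source := by
    rintro e e' ⟨c, j₀, rfl⟩ ⟨c', j₁, rfl⟩
    exact c.isOpen_trans_source c' j₀ j₁
  continuousOn_toFun := by
    rintro e e' ⟨c, j₀, rfl⟩ ⟨c', j₁, rfl⟩
    exact (c.natChart_trans_contDiffOn c' j₀ j₁).continuousOn

instance instTopologicalSpaceJ1 : TopologicalSpace B.J1 := B.j1Core.toTopologicalSpace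

instance instChartedSpaceJ1 : ChartedSpace (J1Model m n) B.J1 := B.j1Core.toChartedSpace

instance instIsManifoldJ1 : IsManifold 𝓘(ℝ, J1Model m n) ∞ B.J1 := by
  refine isManifold_of_contDiffOn _ _ _ fun e e' he he' => ?_
  obtain ⟨_, he⟩ := mem_iUnion.1 he
  obtain ⟨⟨c, j₀, rfl⟩, he⟩ := mem_iUnion.1 he
  obtain ⟨_, he'⟩ := mem_iUnion.1 he'
  obtain ⟨⟨c', j₁, rfl⟩, he'⟩ := mem_iUnion.1 he'
  rw [mem_singleton_iff] at he he'
  subst he he'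
  exact (c.natChart_trans_contDiffOn c' j₀ j₁).mono fun w hw => hw.1


section Lagrangian

variable {B}

/-- The tangent map `T_j π¹ : T_j J¹π → T_y E`. -/
def J1.dpt (j : B.J1) : TangentSpace 𝓘(ℝ, J1Model m n) j →L[ℝ] Eu (m + n) :=
  mfderiv 𝓘(ℝ, J1Model m n) (𝓡 (m + n)) (J1.pt : B.J1 → E) j

/-- The tangent map `T_j π̄¹ = T_y π ∘ T_j π¹ : T_j J¹π → T_x M` of `π̄¹ = π ∘ π¹`. -/
def J1.dbar (j : B.J1) : TangentSpace 𝓘(ℝ, J1Model m n) j →L[ℝ] Eu m :=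
  (B.dproj j.pt).comp j.dpt

/-- The space `T_x^* M ⊗ V_y(π)` of linear maps from `T_x M` to the vertical subspace of `T_y E`,
on which the fibre of `π¹ : J¹π → E` through `j` is modelled as an affine space. -/
def J1.VHom (j : B.J1) : Submodule ℝ (Eu m →L[ℝ] Eu (m + n)) where
  carrier := {k | (B.dproj j.pt).comp k = 0}
  add_mem' {a b} ha hb := by
    change (B.dproj j.pt).comp (a + b) = 0
    rw [ContinuousLinearMap.comp_add, show (B.dproj j.pt).comp a = 0 from ha,
      show (B.dproj j.pt).comp b = 0 from hb, add_zero]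
  zero_mem' := ContinuousLinearMap.comp_zero _
  smul_mem' c a ha := by
    change (B.dproj j.pt).comp (c • a) = 0
    rw [ContinuousLinearMap.comp_smul, show (B.dproj j.pt).comp a = 0 from ha]
    exact smul_zero (A := Eu m →L[ℝ] Eu m) c

/-- The affine structure `j ↦ j + k` of the fibres of `π¹ : J¹π → E`. -/
def J1.addVert (j : B.J1) (k : j.VHom) : B.J1 where
  pt := j.pt
  lin := j.lin + k
  right_inv := by
    have hk : (B.dproj j.pt).comp (k : Eu m →L[ℝ] Eu (m + n)) = 0 := k.2
    rw [ContinuousLinearMap.comp_add, j.right_inv, hk, add_zero]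

theorem J1.addVert_zero (j : B.J1) : j.addVert 0 = j := by
  cases j
  simp [J1.addVert]

/-- The vertical lift `T_x^* M ⊗ V_y(π) ≅ V_j(π¹) ⊆ T_j J¹π`: the tangent map at `0` of
`k ↦ j + k`. -/
def J1.vertLift (j : B.J1) : j.VHom →L[ℝ] TangentSpace 𝓘(ℝ, J1Model m n) j :=
  mfderiv 𝓘(ℝ, j.VHom) 𝓘(ℝ, J1Model m n) j.addVert 0

/-- The structure form of `J¹π`, `θ_j(Z) = T_j π¹(Z) - j(T_j π̄¹(Z))`, with values in `V_y(π)`;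
in natural coordinates it is `(dy^A - v^A_α dx^α) ⊗ ∂/∂y^A`. -/
def J1.structureForm (j : B.J1) : TangentSpace 𝓘(ℝ, J1Model m n) j →L[ℝ] Eu (m + n) :=
  j.dpt - j.lin.comp j.dbar

theorem J1.dproj_structureForm (j : B.J1) (Z : TangentSpace 𝓘(ℝ, J1Model m n) j) :
    B.dproj j.pt (j.structureForm Z) = 0 := by
  have h := DFunLike.congr_fun j.right_inv (j.dbar Z)
  simp only [ContinuousLinearMap.comp_apply, ContinuousLinearMap.id_apply] at h
  simp only [J1.structureForm, sub_apply, map_sub, ContinuousLinearMap.comp_apply, h]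
  simp [J1.dbar]

/-- `β ⊗ θ_j(Z)`, as an element of `T_x^* M ⊗ V_y(π)`. -/
def J1.tensorVert (j : B.J1) (Z : TangentSpace 𝓘(ℝ, J1Model m n) j)
    (β : Module.Dual ℝ (Eu m)) : j.VHom :=
  ⟨(LinearMap.toContinuousLinearMap β).smulRight (j.structureForm Z), by
    change (B.dproj j.pt).comp _ = 0
    ext1 a
    simp [J1.dproj_structureForm]⟩

theorem J1.tensorVert_add_left (j : B.J1) (Z Z' : TangentSpace 𝓘(ℝ, J1Model m n) j)
    (β : Module.Dual ℝ (Eu m)) :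
    j.tensorVert (Z + Z') β = j.tensorVert Z β + j.tensorVert Z' β := by
  apply Subtype.ext
  ext1 a
  change β a • j.structureForm (Z + Z') = β a • j.structureForm Z + β a • j.structureForm Z'
  rw [map_add, smul_add]

theorem J1.tensorVert_smul_left (j : B.J1) (c : ℝ) (Z : TangentSpace 𝓘(ℝ, J1Model m n) j)
    (β : Module.Dual ℝ (Eu m)) : j.tensorVert (c • Z) β = c • j.tensorVert Z β := by
  apply Subtype.ext
  ext1 a
  change β a • j.structureForm (c • Z) = c • (β a • j.structureForm Z)
  rw [map_smul, smul_comm]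

theorem J1.tensorVert_add_right (j : B.J1) (Z : TangentSpace 𝓘(ℝ, J1Model m n) j)
    (β β' : Module.Dual ℝ (Eu m)) :
    j.tensorVert Z (β + β') = j.tensorVert Z β + j.tensorVert Z β' := by
  apply Subtype.ext
  ext1 a
  exact add_smul (β a) (β' a) (j.structureForm Z)

theorem J1.tensorVert_smul_right (j : B.J1) (c : ℝ) (Z : TangentSpace 𝓘(ℝ, J1Model m n) j)
    (β : Module.Dual ℝ (Eu m)) : j.tensorVert Z (c • β) = c • j.tensorVert Z β := by
  apply Subtype.ext
  ext1 a
  exact mul_smul c (β a) (j.structureForm Z)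

/-- The vertical endomorphism `𝒱` of `J¹π`, a section of `T^*J¹π ⊗ V(π¹) ⊗ TM`, as the bilinear
map `𝒱_j(Z, β) = vertical lift of β ⊗ θ_j(Z)` for `Z ∈ T_j J¹π` and `β ∈ T_x^* M`; in natural
coordinates it is `(dy^A - v^A_α dx^α) ⊗ ∂/∂v^A_ν ⊗ ∂/∂x^ν`. -/
def J1.vertEndo (j : B.J1) : TangentSpace 𝓘(ℝ, J1Model m n) j →ₗ[ℝ] Module.Dual ℝ (Eu m) →ₗ[ℝ]
    TangentSpace 𝓘(ℝ, J1Model m n) j :=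
  LinearMap.mk₂ ℝ (fun Z β => j.vertLift (j.tensorVert Z β))
    (fun Z Z' β => by rw [j.tensorVert_add_left, map_add])
    (fun c Z β => by rw [j.tensorVert_smul_left, map_smul])
    (fun Z β β' => by rw [j.tensorVert_add_right, map_add])
    (fun c Z β => by rw [j.tensorVert_smul_right, map_smul])

/-- The differential of `L : J¹π → ℝ`. -/
def J1.dL (j : B.J1) (L : B.J1 → ℝ) : TangentSpace 𝓘(ℝ, J1Model m n) j →L[ℝ] ℝ :=
  mfderiv 𝓘(ℝ, J1Model m n) 𝓘(ℝ, ℝ) L j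

/-- The contraction of the factor `V(π¹)` of `𝒱` with `dL`: a section of `T^*J¹π ⊗ TM`, in natural
coordinates `∂L/∂v^A_ν (dy^A - v^A_α dx^α) ⊗ ∂/∂x^ν`. -/
def J1.vertEndoContract (j : B.J1) (L : B.J1 → ℝ) :
    TangentSpace 𝓘(ℝ, J1Model m n) j →L[ℝ] Eu m where
  toLinearMap := (Module.evalEquiv ℝ (Eu m)).symm.toLinearMap ∘ₗ
    j.vertEndo.compr₂ (j.dL L).toLinearMap
  cont := by
    have : FiniteDimensional ℝ (TangentSpace 𝓘(ℝ, J1Model m n) j) :=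
      inferInstanceAs (FiniteDimensional ℝ (J1Model m n))
    have : T2Space (TangentSpace 𝓘(ℝ, J1Model m n) j) := inferInstanceAs (T2Space (J1Model m n))
    exact LinearMap.continuous_of_finiteDimensional _

variable (η : (x : M) → TangentSpace (𝓡 m) x [⋀^Fin m]→L[ℝ] ℝ) (L : B.J1 → ℝ)

/-- `ω = π̄¹^* η`. -/
def volPullback (j : B.J1) : TangentSpace 𝓘(ℝ, J1Model m n) j [⋀^Fin m]→L[ℝ] ℝ :=
  (η (B.proj j.pt)).compContinuousLinearMap j.dbar

/-- The Poincaré–Cartan `m`-form `Θ_ℒ = i(𝒱)ℒ + ℒ` of the Lagrangian density `ℒ = L ω`; in natural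
coordinates with `ω = dᵐx` it is
`∂L/∂v^A_α (dy^A - v^A_ν dx^ν) ∧ d^{m-1}x_α + L dᵐx`. -/
def thetaL (j : B.J1) : TangentSpace 𝓘(ℝ, J1Model m n) j [⋀^Fin m]→L[ℝ] ℝ :=
  tensorContract (j.vertEndoContract L) j.dbar (η (B.proj j.pt)) + L j • volPullback η j

/-- The Poincaré–Cartan `(m+1)`-form `Ω_ℒ = -dΘ_ℒ`. -/
def omegaL (j : B.J1) : TangentSpace 𝓘(ℝ, J1Model m n) j [⋀^Fin (m + 1)]→L[ℝ] ℝ :=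
  -manifoldExtDeriv (thetaL η L) j

/-- The Hessian of `L` along the fibre of `π¹` through `j`; in natural coordinates it has the
matrix `∂²L/∂v^A_α ∂v^B_ν`. -/
def fibreHessian (j : B.J1) (k₁ k₂ : j.VHom) : ℝ :=
  deriv (fun s : ℝ => deriv (fun t : ℝ => L (j.addVert (s • k₁ + t • k₂))) 0) 0

/-- The Lagrangian system is regular: `Ω_ℒ` is `1`-nondegenerate or `∂²L/∂v^A_α ∂v^B_ν` is a
nonsingular matrix at every point. The first condition implies the second, and they are
equivalent if `m ≥ 2` and `n ≥ 1`. If `m = 1` then the `2`-form `Ω_ℒ` is `1`-degenerate at every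
point, as `dim J¹π = 2n + 1` is odd, and the second condition is the usual notion of regularity. -/
def IsRegularLagrangian : Prop :=
  (∀ j : B.J1, IsOneNondegenerate (omegaL η L j)) ∨
    (∀ (j : B.J1) (k₁ : j.VHom), (∀ k₂ : j.VHom, fibreHessian L j k₁ k₂ = 0) → k₁ = 0)

variable (X : (j : B.J1) → ⋀[ℝ]^m (TangentSpace 𝓘(ℝ, J1Model m n) j))

/-- The `m`-vector field `X` is semi-holonomic: `i(X)𝒱 = 0`. Here `X` is contracted with the factor
`T^*J¹π` of `𝒱`, that is, `i(a)X = 0` for all the components `a = ζ(𝒱(·, β))` of `𝒱`,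
where `i(a)(Y₁ ∧ … ∧ Y_m) = ∑ᵢ (-1)^(i-1) a(Yᵢ) Y₁ ∧ … Ŷᵢ … ∧ Y_m`. -/
def IsSemiHolonomic : Prop :=
  ∀ (j : B.J1) (β : Module.Dual ℝ (Eu m)) (ζ : Module.Dual ℝ (TangentSpace 𝓘(ℝ, J1Model m n) j)),
    CliffordAlgebra.contractLeft (Q := (0 : QuadraticForm ℝ (TangentSpace 𝓘(ℝ, J1Model m n) j)))
      (ζ ∘ₗ j.vertEndo.flip β)
      (X j : ExteriorAlgebra ℝ (TangentSpace 𝓘(ℝ, J1Model m n) j)) = 0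

/-- Euler–Lagrange `m`-vector fields: semi-holonomic locally decomposable solutions of
`i(X)Ω_ℒ = 0`. -/
structure IsEulerLagrange : Prop where
  locallyDecomposable : IsLocallyDecomposable X
  semiHolonomic : IsSemiHolonomic X
  contract_eq_zero : ∀ j, mvContract (X j) (omegaL η L j) = 0

end Lagrangian

end SmoothFibreBundle

end

/-! Work at one point, in natural coordinates. Let `ν` be the value of the volume form there, so
that nearby it is `f ν` with `f = 1` at the point, and write `θ = dy - v dx` for the contact form. A
momentum `p ∈ Hom(X, Y)^*` is read as a map `p^♯ : Y → X` with `β(p^♯ u) = p(β ⊗ u)`. The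
Poincaré–Cartan form is then `f` times the sum of `L ν` and the form obtained by inserting `p^♯ θ`,
`p = ∂L/∂v`, into the slots of `ν` in turn.

The heart of the matter is `dΘ` with one vertical argument `k` (`extDeriv_coordTheta_cons`). Since
`dx` and `θ` kill vertical vectors, `Θ` vanishes whenever its first argument is vertical, so `dΘ(k,
Z)` is just the derivative of `Θ(Z)` in the direction `k`. Differentiating `θ` produces `-p^♯ k dx`.
Inserting an endomorphism of the base into the slots of a top-degree form multiplies that form by
its trace (`sum_map_update_eq_trace`), and `tr(p^♯ k) = p(k)` (`trace_formToHom_comp`), so this term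
cancels the derivative of `L ν`. Only the Hessian of `L` along the fibre, paired with `θ`, remains.

Let `X = Y₁ ∧ … ∧ Y_m` at the point. As `ω(Y₁, …, Y_m) = 1`, the projections `dx(Yᵢ)` form a basis
of the base, and there is a linear `G` with `G dx(Yᵢ) = θ(Yᵢ)`. The trace identity, applied again,
turns `i(X)Ω = 0` on vertical vectors into `Hess(k, G) = 0` for all `k`. A nonsingular Hessian
forces `G = 0`, hence `θ(Yᵢ) = 0`; the vertical endomorphism factors through `θ`, so its contraction
with `X` vanishes.

Both forms of regularity give a nonsingular Hessian: by the same formula a vector in the kernel of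
the Hessian is a vertical vector in the kernel of `Ω`. -/

noncomputable section

set_option linter.unusedSectionVars false

/-! ### Top-degree forms and the trace -/

section TraceIdentity

variable {m : ℕ} {V W : Type*} [AddCommGroup V] [Module ℝ V] [TopologicalSpace V]
  [AddCommGroup W] [Module ℝ W] [TopologicalSpace W]

theorem tensorContract_apply (P T : V →L[ℝ] W) (η : W [⋀^Fin m]→L[ℝ] ℝ) (Z : Fin m → V) :
    tensorContract P T η Z = ∑ i, η (Function.update (fun j => T (Z j)) i (P (Z i))) := rfl

/-- Replacing the vectors of a basis one at a time by their images under an endomorphism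
multiplies a top-degree form by the trace. -/
theorem sum_map_update_basis (b : Module.Basis (Fin m) ℝ W) (η : W [⋀^Fin m]→L[ℝ] ℝ)
    (Q : W →ₗ[ℝ] W) :
    ∑ i, η (Function.update b i (Q (b i))) = LinearMap.trace ℝ W Q * η b := by
  rw [LinearMap.trace_eq_matrix_trace ℝ b, Matrix.trace, Finset.sum_mul]
  refine Finset.sum_congr rfl fun i _ => ?_
  rw [Matrix.diag_apply, LinearMap.toMatrix_apply]
  conv_lhs => rw [← b.sum_repr (Q (b i))]
  have h := η.toMultilinearMap.map_update_sum Finset.univ i (fun j => b.repr (Q (b i)) j • b j) b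
  refine h.trans ((Finset.sum_eq_single i ?_ (by simp)).trans ?_)
  · intro j _ hj
    rw [η.toMultilinearMap.map_update_smul]
    refine smul_eq_zero_of_right _ (η.map_eq_zero_of_eq _ (i := i) (j := j) ?_ hj.symm)
    simp [hj]
  · rw [η.toMultilinearMap.map_update_smul, Function.update_eq_self]
    rfl

/-- Both sides are alternating in `a`, the left one being `tensorContract Q id η`, so they may be
compared on injective families of basis vectors. Such a family is a permuted basis, where
`sum_map_update_basis` applies. -/
theorem sum_map_update_eq_trace [FiniteDimensional ℝ W] (hW : Module.finrank ℝ W = m)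
    (η : W [⋀^Fin m]→L[ℝ] ℝ) (Q : W →L[ℝ] W) (a : Fin m → W) :
    ∑ i, η (Function.update a i (Q (a i))) = LinearMap.trace ℝ W Q.toLinearMap * η a := by
  let b : Module.Basis (Fin m) ℝ W := Module.finBasisOfFinrankEq ℝ W hW
  have h : (tensorContract Q (ContinuousLinearMap.id ℝ W) η).toAlternatingMap =
      LinearMap.trace ℝ W Q.toLinearMap • η.toAlternatingMap := by
    refine Module.Basis.ext_alternating b fun σ hσ => ?_
    let τ : Equiv.Perm (Fin m) := Equiv.ofBijective σ (Finite.injective_iff_bijective.1 hσ)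
    have h := sum_map_update_basis (b.reindex τ.symm) η Q.toLinearMap
    have e : ⇑(b.reindex τ.symm) = fun i => b (σ i) := by
      funext i; simp [τ]
    rw [e] at h
    exact h
  exact DFunLike.congr_fun h a

end TraceIdentity

/-! ### Product rules for the constituents of the Poincaré–Cartan form -/

section Derivatives

variable {m : ℕ} {H W X Y : Type*} [NormedAddCommGroup H] [NormedSpace ℝ H]
  [NormedAddCommGroup W] [NormedSpace ℝ W] [NormedAddCommGroup X] [NormedSpace ℝ X]
  [NormedAddCommGroup Y] [NormedSpace ℝ Y]

/-- `tensorContract` as a continuous linear map of its first argument. -/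
def tensorContractL [FiniteDimensional ℝ W] [FiniteDimensional ℝ X]
    (T : W →L[ℝ] X) (ν : X [⋀^Fin m]→L[ℝ] ℝ) : (W →L[ℝ] X) →L[ℝ] W [⋀^Fin m]→L[ℝ] ℝ :=
  LinearMap.toContinuousLinearMap
    { toFun := fun P => tensorContract P T ν
      map_add' := fun P Q => by
        ext Z
        change tensorContract _ _ _ _ = tensorContract _ _ _ _ + tensorContract _ _ _ _
        simp only [tensorContract_apply, ← Finset.sum_add_distrib]
        exact Finset.sum_congr rfl fun i _ => ν.map_update_add _ _ _ _
      map_smul' := fun c P => by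
        ext Z
        change tensorContract _ _ _ _ = c • tensorContract _ _ _ _
        simp only [tensorContract_apply, Finset.smul_sum]
        exact Finset.sum_congr rfl fun i _ => ν.map_update_smul _ _ _ _ }

theorem tensorContractL_apply [FiniteDimensional ℝ W] [FiniteDimensional ℝ X]
    (T : W →L[ℝ] X) (ν : X [⋀^Fin m]→L[ℝ] ℝ) (P : W →L[ℝ] X) :
    tensorContractL T ν P = tensorContract P T ν := rfl

/-- The product rule for the shape of `momentum`: `g` will be the differential of `L`, `ι` the
vertical inclusion, `Φ` the map `p ↦ p^♯` and `c` the contact form. -/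
theorem exists_hasFDerivAt_clm_comp {w : W} {g : W → W →L[ℝ] ℝ} {g' : W →L[ℝ] W →L[ℝ] ℝ}
    (hg : HasFDerivAt g g' w) (ι : H →L[ℝ] W) (Φ : (H →L[ℝ] ℝ) →L[ℝ] (Y →L[ℝ] X))
    {c : W → W →L[ℝ] Y} {c' : W →L[ℝ] W →L[ℝ] Y} (hc : HasFDerivAt c c' w) :
    ∃ D : W →L[ℝ] W →L[ℝ] X, HasFDerivAt (fun w => (Φ ((g w).comp ι)).comp (c w)) D w ∧
      ∀ u, D u = (Φ ((g' u).comp ι)).comp (c w) + (Φ ((g w).comp ι)).comp (c' u) := by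
  have h := (Φ.comp ((ContinuousLinearMap.compL ℝ H W ℝ).flip ι)).hasFDerivAt.comp w hg
  refine ⟨_, h.clm_comp hc, fun u => ?_⟩
  simp [add_comm]

/-- Only directions with `f' u = 0` matter, because the density `f` depends on the base coordinates
alone and the form is differentiated along the fibres. -/
theorem exists_hasFDerivAt_tensorContract [FiniteDimensional ℝ W] [FiniteDimensional ℝ X] {w : W}
    {f l : W → ℝ} {f' l' : W →L[ℝ] ℝ} (hf : HasFDerivAt f f' w) (hl : HasFDerivAt l l' w)
    {P : W → W →L[ℝ] X} {P' : W →L[ℝ] W →L[ℝ] X} (hP : HasFDerivAt P P' w)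
    (T : W →L[ℝ] X) (ν : X [⋀^Fin m]→L[ℝ] ℝ) :
    ∃ D : W →L[ℝ] W [⋀^Fin m]→L[ℝ] ℝ, HasFDerivAt
      (fun w => f w • (tensorContract (P w) T ν + l w • ν.compContinuousLinearMap T)) D w ∧
      ∀ u, f' u = 0 →
        D u = f w • (tensorContract (P' u) T ν + l' u • ν.compContinuousLinearMap T) := by
  have h1 := (tensorContractL T ν).hasFDerivAt.comp w hP
  refine ⟨_, hf.smul (h1.add (hl.smul_const (ν.compContinuousLinearMap T))), fun u hu => ?_⟩
  simp [hu, tensorContractL_apply]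

end Derivatives

/-! ### The Poincaré–Cartan form on the model space -/

section NaturalCoordinates

variable {m : ℕ} {X Y : Type*} [NormedAddCommGroup X] [NormedSpace ℝ X]
  [NormedAddCommGroup Y] [NormedSpace ℝ Y]

variable (X Y) in
/-- The inclusion of the vertical directions `∂/∂v^A_α`. -/
def vertIncl : (X →L[ℝ] Y) →L[ℝ] X × Y × (X →L[ℝ] Y) :=
  (ContinuousLinearMap.inr ℝ X (Y × (X →L[ℝ] Y))).comp (ContinuousLinearMap.inr ℝ Y (X →L[ℝ] Y))

variable (X Y) in
/-- The differentials `dx^α`. -/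
def baseProj : X × Y × (X →L[ℝ] Y) →L[ℝ] X := ContinuousLinearMap.fst ℝ X (Y × (X →L[ℝ] Y))

/-- The contact forms `dy^A - v^A_α dx^α`. -/
def contactForm (v : X →L[ℝ] Y) : X × Y × (X →L[ℝ] Y) →L[ℝ] Y :=
  (ContinuousLinearMap.fst ℝ Y (X →L[ℝ] Y)).comp
    (ContinuousLinearMap.snd ℝ X (Y × (X →L[ℝ] Y))) - v.comp (baseProj X Y)

theorem vertIncl_apply (k : X →L[ℝ] Y) : vertIncl X Y k = (0, 0, k) := rfl

theorem baseProj_apply (w : X × Y × (X →L[ℝ] Y)) : baseProj X Y w = w.1 := rfl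

theorem contactForm_apply (v : X →L[ℝ] Y) (w : X × Y × (X →L[ℝ] Y)) :
    contactForm v w = w.2.1 - v w.1 := rfl

theorem contactForm_vertIncl (v k : X →L[ℝ] Y) : contactForm v (vertIncl X Y k) = 0 := by
  simp [contactForm_apply, vertIncl_apply]

variable [FiniteDimensional ℝ X] [FiniteDimensional ℝ Y]

variable (X) in
/-- The coordinate forms of a basis of `X`. -/
def coordForm (a : Fin (Module.finrank ℝ X)) : X →L[ℝ] ℝ :=
  LinearMap.toContinuousLinearMap ((Module.finBasis ℝ X).coord a)

theorem sum_coordForm_smul (x : X) :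
    ∑ a, coordForm X a x • Module.finBasis ℝ X a = x := (Module.finBasis ℝ X).sum_repr x

variable (X Y) in
/-- A linear form on `Hom(X, Y)`, as a linear map `Y → X`. -/
def formToHom : ((X →L[ℝ] Y) →L[ℝ] ℝ) →L[ℝ] (Y →L[ℝ] X) :=
  LinearMap.toContinuousLinearMap
    { toFun := fun p => ∑ a, (p.comp
        (ContinuousLinearMap.smulRightL ℝ X Y (coordForm X a))).smulRight (Module.finBasis ℝ X a)
      map_add' := fun p q => by
        rw [← Finset.sum_add_distrib]
        refine Finset.sum_congr rfl fun a _ => ?_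
        ext u : 1
        simp [add_smul]
      map_smul' := fun c p => by
        rw [Finset.smul_sum]
        refine Finset.sum_congr rfl fun a _ => ?_
        ext u : 1
        simp [mul_smul] }

theorem formToHom_apply (p : (X →L[ℝ] Y) →L[ℝ] ℝ) (u : Y) :
    formToHom X Y p u = ∑ a, p ((coordForm X a).smulRight u) • Module.finBasis ℝ X a := by
  simp [formToHom]

/-- This characterises `p^♯` without the auxiliary basis; it follows by expanding `β` in the
coordinate forms. -/
theorem apply_formToHom (p : (X →L[ℝ] Y) →L[ℝ] ℝ) (u : Y) (β : X →L[ℝ] ℝ) :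
    β (formToHom X Y p u) = p (β.smulRight u) := by
  have h : β.smulRight u = ∑ a, β (Module.finBasis ℝ X a) • (coordForm X a).smulRight u := by
    ext1 x
    conv_lhs => rw [← sum_coordForm_smul x]
    simp [smul_smul, mul_comm]
  rw [formToHom_apply, h]
  simp [mul_comm]

/-- `tr(p^♯ ∘ k) = p(k)`. -/
theorem trace_formToHom_comp (p : (X →L[ℝ] Y) →L[ℝ] ℝ) (k : X →L[ℝ] Y) :
    LinearMap.trace ℝ X ((formToHom X Y p).comp k).toLinearMap = p k := by
  have h : k = ∑ a, (coordForm X a).smulRight (k (Module.finBasis ℝ X a)) := by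
    ext1 x
    conv_lhs => rw [← sum_coordForm_smul x]
    simp
  rw [LinearMap.trace_eq_matrix_trace ℝ (Module.finBasis ℝ X), Matrix.trace]
  conv_rhs => rw [h, map_sum]
  refine Finset.sum_congr rfl fun a _ => ?_
  rw [Matrix.diag_apply, LinearMap.toMatrix_apply]
  exact apply_formToHom p (k (Module.finBasis ℝ X a)) (coordForm X a)

/-- The momenta `∂L/∂v^A_α (dy^A - v^A_ν dx^ν) ⊗ ∂/∂x^α`. -/
def momentum (l : X × Y × (X →L[ℝ] Y) → ℝ) (w : X × Y × (X →L[ℝ] Y)) :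
    X × Y × (X →L[ℝ] Y) →L[ℝ] X :=
  (formToHom X Y ((fderiv ℝ l w).comp (vertIncl X Y))).comp (contactForm w.2.2)

/-- The Poincaré–Cartan form in natural coordinates, for the volume form `f ν` on the base. -/
def coordTheta (f : X → ℝ) (ν : X [⋀^Fin m]→L[ℝ] ℝ) (l : X × Y × (X →L[ℝ] Y) → ℝ)
    (w : X × Y × (X →L[ℝ] Y)) : (X × Y × (X →L[ℝ] Y)) [⋀^Fin m]→L[ℝ] ℝ :=
  f w.1 • (tensorContract (momentum l w) (baseProj X Y) ν +
    l w • ν.compContinuousLinearMap (baseProj X Y))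

/-- The vertical derivative of `dy - v dx` comes from the factor `v` alone; it is the source of the
trace term that cancels `dL`. -/
theorem hasFDerivAt_contactForm (w : X × Y × (X →L[ℝ] Y)) :
    ∃ D : X × Y × (X →L[ℝ] Y) →L[ℝ] X × Y × (X →L[ℝ] Y) →L[ℝ] Y,
    HasFDerivAt (fun w : X × Y × (X →L[ℝ] Y) => contactForm w.2.2) D w ∧
      ∀ k, D (vertIncl X Y k) = - k.comp (baseProj X Y) := by
  have h : HasFDerivAt (fun w : X × Y × (X →L[ℝ] Y) => w.2.2)
      ((ContinuousLinearMap.snd ℝ (Y) (X →L[ℝ] Y)).comp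
        (ContinuousLinearMap.snd ℝ (X) (Y × (X →L[ℝ] Y)))) w :=
    ((ContinuousLinearMap.snd ℝ (Y) (X →L[ℝ] Y)).comp
        (ContinuousLinearMap.snd ℝ (X) (Y × (X →L[ℝ] Y)))).hasFDerivAt
  refine ⟨_, (h.clm_comp (hasFDerivAt_const (baseProj X Y) w)).const_sub _, fun k => ?_⟩
  refine ContinuousLinearMap.ext fun Z => ?_
  simp [vertIncl_apply]

theorem hasFDerivAt_momentum {l : X × Y × (X →L[ℝ] Y) → ℝ} {w : X × Y × (X →L[ℝ] Y)}
    (hl : ContDiffAt ℝ 2 l w) :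
    ∃ D : X × Y × (X →L[ℝ] Y) →L[ℝ] X × Y × (X →L[ℝ] Y) →L[ℝ] X, HasFDerivAt (momentum l) D w ∧
      ∀ k, D (vertIncl X Y k) =
        (formToHom X Y ((fderiv ℝ (fderiv ℝ l) w (vertIncl X Y k)).comp (vertIncl X Y))).comp
          (contactForm w.2.2) -
        ((formToHom X Y ((fderiv ℝ l w).comp (vertIncl X Y))).comp k).comp (baseProj X Y) := by
  have h1 : HasFDerivAt (fderiv ℝ l) (fderiv ℝ (fderiv ℝ l) w) w :=
    ((hl.fderiv_right (m := 1) (by norm_num)).differentiableAt (by norm_num)).hasFDerivAt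
  obtain ⟨C, hC, hCk⟩ := hasFDerivAt_contactForm w
  obtain ⟨D, hD, hDk⟩ := exists_hasFDerivAt_clm_comp h1 (vertIncl X Y) (formToHom X Y) hC
  refine ⟨D, hD, fun k => ?_⟩
  rw [hDk, hCk, ContinuousLinearMap.comp_neg, ← sub_eq_add_neg]
  rfl

/-- Of the two terms in the derivative of the momentum, the one containing `k dx` cancels the
derivative of `L ν`; what is left is linear in the Hessian of `L`. -/
theorem hasFDerivAt_coordTheta (hX : Module.finrank ℝ X = m) {f : X → ℝ} {ν : X [⋀^Fin m]→L[ℝ] ℝ}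
    {l : X × Y × (X →L[ℝ] Y) → ℝ} {w : X × Y × (X →L[ℝ] Y)} (hf : DifferentiableAt ℝ f w.1)
    (hl : ContDiffAt ℝ 2 l w) :
    ∃ D : X × Y × (X →L[ℝ] Y) →L[ℝ] (X × Y × (X →L[ℝ] Y)) [⋀^Fin m]→L[ℝ] ℝ,
      HasFDerivAt (coordTheta f ν l) D w ∧
      ∀ k, D (vertIncl X Y k) = f w.1 • tensorContract
        ((formToHom X Y ((fderiv ℝ (fderiv ℝ l) w (vertIncl X Y k)).comp (vertIncl X Y))).comp
          (contactForm w.2.2)) (baseProj X Y) ν := by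
  obtain ⟨P', hP, hPk⟩ := hasFDerivAt_momentum hl
  have h3 : HasFDerivAt (fun w : X × Y × (X →L[ℝ] Y) => f w.1)
      ((fderiv ℝ f w.1).comp (baseProj X Y)) w :=
    hf.hasFDerivAt.comp w (baseProj X Y).hasFDerivAt
  obtain ⟨D, hD, hDk⟩ := exists_hasFDerivAt_tensorContract h3
    (hl.differentiableAt (by norm_num)).hasFDerivAt hP (baseProj X Y) ν
  refine ⟨D, hD, fun k => ?_⟩
  -- The trace identity for the endomorphism `p^♯ k` of the base, with `tr(p^♯ k) = p(k)`.
  have ht : tensorContract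
      (((formToHom X Y ((fderiv ℝ l w).comp (vertIncl X Y))).comp k).comp (baseProj X Y))
        (baseProj X Y) ν =
      fderiv ℝ l w (vertIncl X Y k) • ν.compContinuousLinearMap (baseProj X Y) := by
    ext Z
    have h := sum_map_update_eq_trace hX ν
      ((formToHom X Y ((fderiv ℝ l w).comp (vertIncl X Y))).comp k) fun i => baseProj X Y (Z i)
    rw [trace_formToHom_comp] at h
    exact h
  rw [hDk _ (by simp [vertIncl_apply, baseProj_apply]), hPk, ← tensorContractL_apply, map_sub,
    tensorContractL_apply, tensorContractL_apply, ht, sub_add_cancel]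

/-- Both `dx` and the momentum, which factors through the contact form, kill vertical vectors, so
every summand has a zero in slot `0`. -/
theorem coordTheta_cons_vertIncl (f : X → ℝ) (ν : X [⋀^Fin (m + 1)]→L[ℝ] ℝ)
    (l : X × Y × (X →L[ℝ] Y) → ℝ) (w : X × Y × (X →L[ℝ] Y)) (Z : Fin (m + 1) → X × Y × (X →L[ℝ] Y))
    (k : X →L[ℝ] Y) (hZ : Z 0 = vertIncl X Y k) :
    coordTheta f ν l w Z = 0 := by
  have h0 : baseProj X Y (Z 0) = 0 := by rw [hZ]; rfl
  have h1 : momentum l w (Z 0) = 0 := by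
    rw [hZ]
    simp [momentum, contactForm_vertIncl]
  change f w.1 • (tensorContract (momentum l w) (baseProj X Y) ν Z +
    l w • ν (fun i => baseProj X Y (Z i))) = 0
  rw [ν.map_coord_zero 0 h0, tensorContract_apply, Finset.sum_eq_zero]
  · simp
  · intro i _
    refine ν.map_coord_zero 0 ?_
    rcases eq_or_ne i 0 with rfl | h
    · simp [h1]
    · simp [h.symm, h0]

/-- `i(∂/∂v)dΘ` in natural coordinates. -/
theorem extDeriv_coordTheta_cons (hX : Module.finrank ℝ X = m) {f : X → ℝ} {ν : X [⋀^Fin m]→L[ℝ] ℝ}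
    {l : X × Y × (X →L[ℝ] Y) → ℝ}
    {w : X × Y × (X →L[ℝ] Y)} (hf : DifferentiableAt ℝ f w.1) (hl : ContDiffAt ℝ 2 l w)
    (k : X →L[ℝ] Y) (Z : Fin m → X × Y × (X →L[ℝ] Y)) :
    extDeriv (coordTheta f ν l) w (Fin.cons (vertIncl X Y k) Z) =
      f w.1 * tensorContract
        ((formToHom X Y ((fderiv ℝ (fderiv ℝ l) w (vertIncl X Y k)).comp (vertIncl X Y))).comp
          (contactForm w.2.2)) (baseProj X Y) ν Z := by
  obtain ⟨D, hD, hDk⟩ := hasFDerivAt_coordTheta hX (ν := ν) hf hl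
  -- The summand of index `0` differentiates in the direction `k`. All others keep `k` as first
  -- argument of `Θ`, so they differentiate the zero function; for `m = 0` there are none.
  rw [extDeriv_apply hD.differentiableAt, Fin.sum_univ_succ, Finset.sum_eq_zero, add_zero]
  · have h : Fin.removeNth 0 (Fin.cons (vertIncl X Y k) Z : Fin (m + 1) →
            X × Y × (X →L[ℝ] Y)) = Z := by
      funext i; simp [Fin.removeNth]
    rw [h, fderiv_continuousAlternatingMap_apply_const_apply hD.differentiableAt, hD.fderiv,
      Fin.cons_zero, hDk]
    simp
  · intro i _
    cases m with
    | zero => exact i.elim0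
    | succ m =>
      have h : (fun w => coordTheta f ν l w
          (i.succ.removeNth (Fin.cons (vertIncl X Y k) Z : Fin (m + 2) → X × Y × (X →L[ℝ] Y)))) =
            fun _ => 0 := by
        funext w
        exact coordTheta_cons_vertIncl f ν l w _ k (by simp [Fin.removeNth])
      rw [h]
      simp

/-- On the vectors `Zᵢ` the contact form factors as `G dx`, so the contraction inserts the
endomorphism `p^♯ G` of the base, whose trace is `p(G)`. -/
theorem tensorContract_formToHom (hX : Module.finrank ℝ X = m) {ν : X [⋀^Fin m]→L[ℝ] ℝ}
    (p : (X →L[ℝ] Y) →L[ℝ] ℝ)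
    (v G : X →L[ℝ] Y) (Z : Fin m → X × Y × (X →L[ℝ] Y))
    (hG : ∀ i, G (baseProj X Y (Z i)) = contactForm v (Z i)) :
    tensorContract ((formToHom X Y p).comp (contactForm v)) (baseProj X Y) ν Z =
      p G * ν fun i => baseProj X Y (Z i) := by
  have h := sum_map_update_eq_trace hX ν ((formToHom X Y p).comp G)
    fun i => baseProj X Y (Z i)
  rw [trace_formToHom_comp] at h
  rw [← h, tensorContract_apply]
  simp [hG]

theorem linearIndependent_of_form_ne_zero {W : Type*} [NormedAddCommGroup W] [NormedSpace ℝ W]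
    (ν : W [⋀^Fin m]→L[ℝ] ℝ) {a : Fin m → W} (h : ν a ≠ 0) : LinearIndependent ℝ a := by
  by_contra hc
  exact h (ν.toAlternatingMap.map_linearDependent a hc)

/-- Regularity makes `i(∂/∂v)dΘ = 0` imply the vanishing of the contact forms. -/
theorem contactForm_eq_zero (hX : Module.finrank ℝ X = m) {f : X → ℝ} {ν : X [⋀^Fin m]→L[ℝ] ℝ}
    {l : X × Y × (X →L[ℝ] Y) → ℝ}
    {w : X × Y × (X →L[ℝ] Y)} (hf : DifferentiableAt ℝ f w.1) (hl : ContDiffAt ℝ 2 l w)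
    (hreg : ∀ k₁, (∀ k₂, fderiv ℝ (fderiv ℝ l) w (vertIncl X Y k₁) (vertIncl X Y k₂) = 0) → k₁ = 0)
    (hf0 : f w.1 ≠ 0) (Z : Fin m → X × Y × (X →L[ℝ] Y)) (hZ : ν (fun i => baseProj X Y (Z i)) ≠ 0)
    (hd : ∀ k, extDeriv (coordTheta f ν l) w (Fin.cons (vertIncl X Y k) Z) = 0) (i : Fin m) :
    contactForm w.2.2 (Z i) = 0 := by
  have hli := linearIndependent_of_form_ne_zero ν hZ
  let b := basisOfLinearIndependentOfCardEqFinrank' _ hli (by simp [hX])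
  have hb : ∀ i, b i = baseProj X Y (Z i) := fun i => by simp [b]
  -- The projections `dx(Zᵢ)` form a basis because `ν` does not vanish on them; `G` is thus
  -- determined by its values there.
  let G : X →L[ℝ] Y :=
    LinearMap.toContinuousLinearMap (b.constr ℝ fun i => contactForm w.2.2 (Z i))
  have hG : ∀ i, G (baseProj X Y (Z i)) = contactForm w.2.2 (Z i) := fun i => by
    rw [← hb]; exact b.constr_basis ℝ _ i
  -- The formula for `dΘ` has `G` in the second slot of the Hessian, whereas `hreg` wants it in the
  -- first.
  have hsymm : IsSymmSndFDerivAt ℝ l w := hl.isSymmSndFDerivAt (by simp)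
  have hG0 : G = 0 := by
    refine hreg G fun k => ?_
    have h := hd k
    rw [extDeriv_coordTheta_cons hX hf hl, tensorContract_formToHom hX _ _ G Z hG] at h
    rw [hsymm.eq]
    simpa [hf0, hZ] using h
  rw [← hG, hG0]
  rfl

/-- The kernel of the fibre Hessian lies in the kernel of `dΘ`; this is how `1`-nondegeneracy yields
a nonsingular Hessian. -/
theorem extDeriv_coordTheta_cons_eq_zero (hX : Module.finrank ℝ X = m) {f : X → ℝ}
    {ν : X [⋀^Fin m]→L[ℝ] ℝ}
    {l : X × Y × (X →L[ℝ] Y) → ℝ} {w : X × Y × (X →L[ℝ] Y)} (hf : DifferentiableAt ℝ f w.1)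
    (hl : ContDiffAt ℝ 2 l w) (k : X →L[ℝ] Y)
    (hk : ∀ k₂, fderiv ℝ (fderiv ℝ l) w (vertIncl X Y k) (vertIncl X Y k₂) = 0)
    (Z : Fin m → X × Y × (X →L[ℝ] Y)) :
    extDeriv (coordTheta f ν l) w (Fin.cons (vertIncl X Y k) Z) = 0 := by
  have h : (fderiv ℝ (fderiv ℝ l) w (vertIncl X Y k)).comp (vertIncl X Y) = 0 := by
    ext1 k₂; exact hk k₂
  rw [extDeriv_coordTheta_cons hX hf hl, h, ← tensorContractL_apply]
  simp

end NaturalCoordinates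

/-! ### Jet bundle structures in natural charts -/

theorem hasMFDerivAt_const_add_clm {V W : Type*} [NormedAddCommGroup V] [NormedSpace ℝ V]
    [NormedAddCommGroup W] [NormedSpace ℝ W] (A : V →L[ℝ] W) (w : W) (v : V) :
    HasMFDerivAt 𝓘(ℝ, V) 𝓘(ℝ, W) (fun v => w + A v) v A :=
  (A.hasFDerivAt.const_add w).hasMFDerivAt

namespace SmoothFibreBundle

variable {m n : ℕ} {M F E : Type*}
  [TopologicalSpace M] [ChartedSpace (Eu m) M] [IsManifold (𝓡 m) ∞ M]
  [TopologicalSpace F] [ChartedSpace (Eu n) F] [IsManifold (𝓡 n) ∞ F]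
  [TopologicalSpace E] [ChartedSpace (Eu (m + n)) E] [IsManifold (𝓡 (m + n)) ∞ E]
  {B : SmoothFibreBundle m n M F E}

namespace J1

/-- The fibred chart inducing the preferred chart of `J¹π` at `j₀`. -/
def fibredChart (j₀ : B.J1) : B.FibredChart := (B.exists_fibredChart j₀.pt).choose

theorem mem_fibredChart_source (j₀ : B.J1) : j₀.pt ∈ j₀.fibredChart.total.source :=
  (B.exists_fibredChart j₀.pt).choose_spec

theorem chartAt_apply (j₀ j : B.J1) : chartAt (J1Model m n) j₀ j =
    ((j₀.fibredChart.total j.pt).1, (j₀.fibredChart.total j.pt).2, j₀.fibredChart.velocity j) := rfl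

theorem mem_chartAt_target {j₀ : B.J1} {w : J1Model m n} :
    w ∈ (chartAt (J1Model m n) j₀).target ↔ (w.1, w.2.1) ∈ j₀.fibredChart.total.target := Iff.rfl

theorem chartAt_symm_apply {j₀ : B.J1} {w : J1Model m n}
    (hw : w ∈ (chartAt (J1Model m n) j₀).target) :
    (chartAt (J1Model m n) j₀).symm w =
      ⟨j₀.fibredChart.total.symm (w.1, w.2.1), j₀.fibredChart.linOf (w.1, w.2.1) w.2.2,
        j₀.fibredChart.dproj_linOf hw w.2.2⟩ :=
  j₀.fibredChart.natChart_symm_apply j₀ hw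

theorem chartAt_symm_pt {j₀ : B.J1} {w : J1Model m n}
    (hw : w ∈ (chartAt (J1Model m n) j₀).target) :
    ((chartAt (J1Model m n) j₀).symm w).pt = j₀.fibredChart.total.symm (w.1, w.2.1) := by
  rw [chartAt_symm_apply hw]

theorem chartAt_symm_lin {j₀ : B.J1} {w : J1Model m n}
    (hw : w ∈ (chartAt (J1Model m n) j₀).target) :
    ((chartAt (J1Model m n) j₀).symm w).lin = j₀.fibredChart.linOf (w.1, w.2.1) w.2.2 := by
  rw [chartAt_symm_apply hw]

/-- The tangent map of the inverse of the preferred chart at `j₀`. -/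
def dsymm (j₀ : B.J1) (w : J1Model m n) :
    J1Model m n →L[ℝ] TangentSpace 𝓘(ℝ, J1Model m n) ((chartAt (J1Model m n) j₀).symm w) :=
  mfderiv 𝓘(ℝ, J1Model m n) 𝓘(ℝ, J1Model m n) (chartAt (J1Model m n) j₀).symm w

theorem chartAt_mdiff (j₀ : B.J1) :
    (chartAt (J1Model m n) j₀).MDifferentiable 𝓘(ℝ, J1Model m n) 𝓘(ℝ, J1Model m n) :=
  mdifferentiable_chart j₀

theorem hasMFDerivAt_total_symm {c : B.FibredChart} {w : J1Model m n}
    (hw : (w.1, w.2.1) ∈ c.total.target) :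
    HasMFDerivAt 𝓘(ℝ, J1Model m n) (𝓡 (m + n)) (fun w : J1Model m n => c.total.symm (w.1, w.2.1)) w
      ((c.dtotalSymm (w.1, w.2.1)).comp
        ((ContinuousLinearMap.fst ℝ _ _).prod ((ContinuousLinearMap.fst ℝ _ _).comp
          (ContinuousLinearMap.snd ℝ (Eu m) (Eu n × (Eu m →L[ℝ] Eu n)))))) := by
  let Φ : J1Model m n →L[ℝ] Eu m × Eu n :=
    (ContinuousLinearMap.fst ℝ _ _).prod ((ContinuousLinearMap.fst ℝ _ _).comp
      (ContinuousLinearMap.snd ℝ (Eu m) (Eu n × (Eu m →L[ℝ] Eu n))))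
  have h1 : HasMFDerivAt 𝓘(ℝ, J1Model m n) 𝓘(ℝ, Eu m × Eu n) Φ w Φ :=
    Φ.hasFDerivAt.hasMFDerivAt
  exact HasMFDerivAt.comp w (f := Φ) (g := c.total.symm)
    (c.total_mdiff.mdifferentiableAt_symm hw).hasMFDerivAt h1

theorem mdifferentiableAt_pt {j₀ j : B.J1} (hj : j ∈ (chartAt (J1Model m n) j₀).source) :
    MDifferentiableAt 𝓘(ℝ, J1Model m n) (𝓡 (m + n)) (J1.pt : B.J1 → E) j := by
  have h1 := MDifferentiableAt.comp j (f := chartAt (J1Model m n) j₀)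
    (hasMFDerivAt_total_symm (c := j₀.fibredChart)
      ((chartAt (J1Model m n) j₀).map_source hj)).mdifferentiableAt
    ((chartAt_mdiff j₀).mdifferentiableAt hj)
  refine h1.congr_of_eventuallyEq ?_
  filter_upwards [(chartAt (J1Model m n) j₀).open_source.mem_nhds hj] with i hi
  exact (j₀.fibredChart.total.left_inv hi).symm

variable {j₀ : B.J1} {w : J1Model m n}

theorem dpt_dsymm (hw : w ∈ (chartAt (J1Model m n) j₀).target) (Z : J1Model m n) :
    J1.dpt _ (dsymm j₀ w Z) = j₀.fibredChart.dtotalSymm (w.1, w.2.1) (Z.1, Z.2.1) := by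
  have h1 := HasMFDerivAt.comp w
    (mdifferentiableAt_pt ((chartAt (J1Model m n) j₀).map_target hw)).hasMFDerivAt
    ((chartAt_mdiff j₀).mdifferentiableAt_symm hw).hasMFDerivAt
  have h2 : (J1.pt ∘ (chartAt (J1Model m n) j₀).symm) =ᶠ[𝓝 w]
      (fun w : J1Model m n => j₀.fibredChart.total.symm (w.1, w.2.1)) := by
    filter_upwards [(chartAt (J1Model m n) j₀).open_target.mem_nhds hw] with z hz
    exact chartAt_symm_pt hz
  have h3 := (hasMFDerivAt_total_symm (c := j₀.fibredChart) hw).congr_of_eventuallyEq h2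
  exact DFunLike.congr_fun (hasMFDerivAt_unique h1 h3) Z

theorem dbar_dsymm (hw : w ∈ (chartAt (J1Model m n) j₀).target) (Z : J1Model m n) :
    J1.dbar _ (dsymm j₀ w Z) = j₀.fibredChart.dbaseSymm w.1 (baseProj _ _ Z) := by
  set c := j₀.fibredChart
  have hy : c.total.symm (w.1, w.2.1) ∈ c.total.source := c.total.map_target hw
  -- Insert the base chart after `dπ`: by `dbase_dproj` the composite is the first component of the
  -- chart of `E`.
  have h1 := DFunLike.congr_fun (c.dbaseSymm_dbase (c.proj_mem _ hy))
    (B.dproj (c.total.symm (w.1, w.2.1)) (c.dtotalSymm (w.1, w.2.1) (Z.1, Z.2.1)))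
  have h2 := DFunLike.congr_fun (c.dbase_dproj hy) (c.dtotalSymm (w.1, w.2.1) (Z.1, Z.2.1))
  have h3 := DFunLike.congr_fun (c.dtotal_dtotalSymm hw) (Z.1, Z.2.1)
  simp only [ContinuousLinearMap.comp_apply, ContinuousLinearMap.id_apply,
    ContinuousLinearMap.coe_fst'] at h1 h2 h3
  rw [h2, h3, c.base_proj _ hy, c.total.right_inv hw] at h1
  rw [J1.dbar, ContinuousLinearMap.comp_apply, dpt_dsymm hw, chartAt_symm_pt hw, ← h1]
  rfl

theorem base_symm_mem (hw : w ∈ (chartAt (J1Model m n) j₀).target) :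
    w.1 ∈ j₀.fibredChart.base.target := by
  have hy := j₀.fibredChart.total.map_target (mem_chartAt_target.1 hw)
  have h := j₀.fibredChart.base.map_source (j₀.fibredChart.proj_mem _ hy)
  rwa [j₀.fibredChart.base_proj _ hy, j₀.fibredChart.total.right_inv (mem_chartAt_target.1 hw)] at h

theorem lin_dbaseSymm (hw : w ∈ (chartAt (J1Model m n) j₀).target) (a : Eu m) :
    ((chartAt (J1Model m n) j₀).symm w).lin (j₀.fibredChart.dbaseSymm w.1 a) =
      j₀.fibredChart.dtotalSymm (w.1, w.2.1) (a, w.2.2 a) := by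
  have h := DFunLike.congr_fun (j₀.fibredChart.dbase_dbaseSymm (base_symm_mem hw)) a
  simp only [ContinuousLinearMap.comp_apply, ContinuousLinearMap.id_apply] at h
  rw [chartAt_symm_lin hw]
  simp only [FibredChart.linOf, ContinuousLinearMap.comp_apply,
    j₀.fibredChart.base_symm_fst (mem_chartAt_target.1 hw), h]
  rfl

theorem structureForm_dsymm (hw : w ∈ (chartAt (J1Model m n) j₀).target) (Z : J1Model m n) :
    J1.structureForm _ (dsymm j₀ w Z) =
      j₀.fibredChart.dtotalSymm (w.1, w.2.1) (0, contactForm w.2.2 Z) := by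
  change J1.dpt _ (dsymm j₀ w Z) - J1.lin _ (J1.dbar _ (dsymm j₀ w Z)) = _
  rw [dpt_dsymm hw, dbar_dsymm hw, lin_dbaseSymm hw, ← map_sub]
  simp [contactForm_apply, baseProj_apply]

/-- The natural coordinates `k^A_α` of an element of `T_x^*M ⊗ V_y(π)`. -/
def vertCoord (c : B.FibredChart) (j : B.J1) : j.VHom →L[ℝ] Eu m →L[ℝ] Eu n :=
  (((ContinuousLinearMap.compL ℝ (Eu m) (Eu m) (Eu n)).flip
      (c.dbaseSymm (c.total j.pt).1)).comp
    (ContinuousLinearMap.compL ℝ (Eu m) (Eu (m + n)) (Eu n)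
      ((ContinuousLinearMap.snd ℝ (Eu m) (Eu n)).comp (c.dtotal j.pt)))).comp j.VHom.subtypeL

theorem vertCoord_apply (c : B.FibredChart) (j : B.J1) (k : j.VHom) (a : Eu m) :
    vertCoord c j k a =
      (c.dtotal j.pt ((k : Eu m →L[ℝ] Eu (m + n)) (c.dbaseSymm (c.total j.pt).1 a))).2 := rfl

/-- Velocities depend affinely on the linear part of a jet, so translation in a fibre is translation
of `v` in the chart. Both the vertical lift and the fibre Hessian are computed from this. -/
theorem addVert_eq (j₀ j : B.J1) (hj : j ∈ (chartAt (J1Model m n) j₀).source) (k : j.VHom) :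
    j.addVert k = (chartAt (J1Model m n) j₀).symm
      (chartAt (J1Model m n) j₀ j + vertIncl _ _ (vertCoord j₀.fibredChart j k)) := by
  have h : chartAt (J1Model m n) j₀ (j.addVert k) =
      chartAt (J1Model m n) j₀ j + vertIncl _ _ (vertCoord j₀.fibredChart j k) := by
    rw [chartAt_apply, chartAt_apply, vertIncl_apply]
    refine Prod.ext (add_zero _).symm (Prod.ext (add_zero _).symm ?_)
    ext1 a
    change (j₀.fibredChart.dtotal j.pt ((j.lin + k) _)).2 = (j₀.fibredChart.dtotal j.pt _).2 +
      (j₀.fibredChart.dtotal j.pt _).2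
    rw [← Prod.snd_add, ← map_add]
    rfl
  rw [← h]
  exact ((chartAt (J1Model m n) j₀).left_inv (x := j.addVert k) hj).symm

/-- The coordinate expression of a function on `J¹π`. -/
def coordFun (j₀ : B.J1) (L : B.J1 → ℝ) : J1Model m n → ℝ := L ∘ (chartAt (J1Model m n) j₀).symm

theorem contDiffOn_coordFun (j₀ : B.J1) {L : B.J1 → ℝ}
    (hL : ContMDiff 𝓘(ℝ, J1Model m n) 𝓘(ℝ, ℝ) ∞ L) :
    ContDiffOn ℝ ∞ (coordFun j₀ L) (chartAt (J1Model m n) j₀).target := by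
  rw [← contMDiffOn_iff_contDiffOn]
  exact hL.comp_contMDiffOn (contMDiffOn_chart_symm (I := 𝓘(ℝ, J1Model m n)) (x := j₀))

theorem dL_dsymm (hw : w ∈ (chartAt (J1Model m n) j₀).target) {L : B.J1 → ℝ}
    (hL : ContMDiff 𝓘(ℝ, J1Model m n) 𝓘(ℝ, ℝ) ∞ L) (Z : J1Model m n) :
    J1.dL _ L (dsymm j₀ w Z) = fderiv ℝ (coordFun j₀ L) w Z := by
  have h1 := mfderiv_comp w (hL.mdifferentiableAt (by simp))
    ((chartAt_mdiff j₀).mdifferentiableAt_symm hw)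
  rw [mfderiv_eq_fderiv] at h1
  exact (DFunLike.congr_fun h1 Z).symm

theorem hasMFDerivAt_addVert {j : B.J1} (hj : j ∈ (chartAt (J1Model m n) j₀).source) :
    HasMFDerivAt 𝓘(ℝ, j.VHom) 𝓘(ℝ, J1Model m n) j.addVert 0
      ((dsymm j₀ (chartAt (J1Model m n) j₀ j)).comp
        ((vertIncl (Eu m) (Eu n)).comp (vertCoord j₀.fibredChart j))) := by
  have h1 : HasMFDerivAt 𝓘(ℝ, j.VHom) 𝓘(ℝ, J1Model m n) (fun k => chartAt (J1Model m n) j₀ j +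
      (vertIncl (Eu m) (Eu n)).comp (vertCoord j₀.fibredChart j) k) 0
      ((vertIncl (Eu m) (Eu n)).comp (vertCoord j₀.fibredChart j)) :=
    hasMFDerivAt_const_add_clm _ _ _
  have h2 : HasMFDerivAt 𝓘(ℝ, J1Model m n) 𝓘(ℝ, J1Model m n) (chartAt (J1Model m n) j₀).symm
      (chartAt (J1Model m n) j₀ j +
        (vertIncl (Eu m) (Eu n)).comp (vertCoord j₀.fibredChart j) 0)
      (dsymm j₀ (chartAt (J1Model m n) j₀ j)) := by
    rw [map_zero, add_zero]
    exact ((chartAt_mdiff j₀).mdifferentiableAt_symm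
      ((chartAt (J1Model m n) j₀).map_source hj)).hasMFDerivAt
  have h4 : j.addVert = (chartAt (J1Model m n) j₀).symm ∘ fun k => chartAt (J1Model m n) j₀ j +
      (vertIncl (Eu m) (Eu n)).comp (vertCoord j₀.fibredChart j) k :=
    funext fun k => addVert_eq j₀ j hj k
  rw [h4]
  exact HasMFDerivAt.comp (0 : j.VHom) h2 h1

theorem vertLift_eq (hw : w ∈ (chartAt (J1Model m n) j₀).target)
    (k : ((chartAt (J1Model m n) j₀).symm w).VHom) :
    J1.vertLift _ k = dsymm j₀ w (vertIncl _ _ (vertCoord j₀.fibredChart _ k)) := by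
  have h := DFunLike.congr_fun
    (hasMFDerivAt_addVert ((chartAt (J1Model m n) j₀).map_target hw)).mfderiv k
  have e := (chartAt (J1Model m n) j₀).right_inv hw
  have h2 : (dsymm j₀ (chartAt (J1Model m n) j₀ ((chartAt (J1Model m n) j₀).symm w)) :
      J1Model m n →L[ℝ] J1Model m n) = dsymm j₀ w := by rw [e]
  exact h.trans (DFunLike.congr_fun h2 _)

theorem vertCoord_tensorVert (hw : w ∈ (chartAt (J1Model m n) j₀).target) (Z : J1Model m n)
    (β : Module.Dual ℝ (Eu m)) :
    vertCoord j₀.fibredChart _ (J1.tensorVert _ (dsymm j₀ w Z) β) =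
      ((LinearMap.toContinuousLinearMap β).comp (j₀.fibredChart.dbaseSymm w.1)).smulRight
        (contactForm w.2.2 Z) := by
  have h := DFunLike.congr_fun (j₀.fibredChart.dtotal_dtotalSymm (mem_chartAt_target.1 hw))
    (0, contactForm w.2.2 Z)
  simp only [ContinuousLinearMap.comp_apply, ContinuousLinearMap.id_apply] at h
  ext1 a
  rw [vertCoord_apply]
  change (j₀.fibredChart.dtotal _ (β _ • J1.structureForm _ (dsymm j₀ w Z))).2 = β _ • _
  rw [structureForm_dsymm hw, map_smul, chartAt_symm_pt hw, h,
    j₀.fibredChart.total.right_inv (mem_chartAt_target.1 hw)]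
  rfl

theorem vertEndoContract_dsymm (hw : w ∈ (chartAt (J1Model m n) j₀).target) {L : B.J1 → ℝ}
    (hL : ContMDiff 𝓘(ℝ, J1Model m n) 𝓘(ℝ, ℝ) ∞ L) (Z : J1Model m n) :
    J1.vertEndoContract _ L (dsymm j₀ w Z) =
      j₀.fibredChart.dbaseSymm w.1 (momentum (coordFun j₀ L) w Z) := by
  -- The contracted endomorphism is defined through the double dual, so it is compared by pairing
  -- with covectors `β`; `apply_formToHom` then identifies `dL` on the lift of `β ⊗ θ(Z)`.
  refine (Module.forall_dual_apply_eq_zero_iff ℝ _).1 ?_ |> sub_eq_zero.1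
  intro β
  rw [map_sub, sub_eq_zero]
  have h1 : β (J1.vertEndoContract _ L (dsymm j₀ w Z)) =
      J1.dL _ L (J1.vertLift _ (J1.tensorVert _ (dsymm j₀ w Z) β)) :=
    Module.apply_evalEquiv_symm_apply ℝ (Eu m) β _
  rw [h1, vertLift_eq hw, vertCoord_tensorVert hw, dL_dsymm hw hL]
  exact (apply_formToHom ((fderiv ℝ (coordFun j₀ L) w).comp (vertIncl _ _)) (contactForm w.2.2 Z)
    ((LinearMap.toContinuousLinearMap β).comp (j₀.fibredChart.dbaseSymm w.1))).symm

end J1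

end SmoothFibreBundle

/-! ### Iterated derivatives, top-degree forms and contractions of multivectors -/

theorem deriv_deriv_eq_fderiv_fderiv {W : Type*} [NormedAddCommGroup W] [NormedSpace ℝ W]
    {l : W → ℝ} {w : W} (hl : ContDiffAt ℝ 2 l w) (a b : W) :
    deriv (fun s : ℝ => deriv (fun t : ℝ => l (w + (s • a + t • b))) 0) 0 =
      fderiv ℝ (fderiv ℝ l) w a b := by
  have hcurve : HasDerivAt (fun s : ℝ => w + s • a) a 0 := by
    simpa using ((hasDerivAt_id (0 : ℝ)).smul_const a).const_add w
  have hcont : Filter.Tendsto (fun s : ℝ => w + s • a) (𝓝 0) (𝓝 w) := by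
    have h := hcurve.continuousAt.tendsto
    simpa using h
  have hev : ∀ᶠ s : ℝ in 𝓝 0, DifferentiableAt ℝ l (w + s • a) := by
    refine hcont.eventually ?_
    filter_upwards [hl.eventually (by simp)] with z hz
    exact hz.differentiableAt (by norm_num)
  -- The inner derivative is known only for small `s`, where `l` is differentiable; the outer
  -- derivative at `0` needs no more.
  have h1 : (fun s : ℝ => deriv (fun t : ℝ => l (w + (s • a + t • b))) 0) =ᶠ[𝓝 0]
      fun s => fderiv ℝ l (w + s • a) b := by
    filter_upwards [hev] with s hs
    have hc : HasDerivAt (fun t : ℝ => w + (s • a + t • b)) b 0 := by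
      simpa using (((hasDerivAt_id (0 : ℝ)).smul_const b).const_add (s • a)).const_add w
    have e : w + (s • a + (0 : ℝ) • b) = w + s • a := by simp
    have hs' : HasFDerivAt l (fderiv ℝ l (w + s • a)) (w + (s • a + (0 : ℝ) • b)) := by
      rw [e]; exact hs.hasFDerivAt
    exact (HasFDerivAt.comp_hasDerivAt (f := fun t : ℝ => w + (s • a + t • b)) 0 hs' hc).deriv
  rw [h1.deriv_eq]
  have e : w + (0 : ℝ) • a = w := by simp
  have h2 : HasFDerivAt (fderiv ℝ l) (fderiv ℝ (fderiv ℝ l) w) (w + (0 : ℝ) • a) := by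
    rw [e]
    exact ((hl.fderiv_right (m := 1) (by norm_num)).differentiableAt (by norm_num)).hasFDerivAt
  have h3 := HasFDerivAt.comp_hasDerivAt (f := fun s : ℝ => w + s • a) 0 h2 hcurve
  have h4 := ((ContinuousLinearMap.apply ℝ ℝ b).hasFDerivAt (x := fderiv ℝ l (w + (0 : ℝ) • a)))
  exact (HasFDerivAt.comp_hasDerivAt (f := fun s : ℝ => fderiv ℝ l (w + s • a)) 0 h4 h3).deriv

/-- All forms of top degree are multiples of a nonzero one. -/
theorem exists_eq_smul_form {m : ℕ} {W : Type*} [NormedAddCommGroup W] [NormedSpace ℝ W]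
    [FiniteDimensional ℝ W] (hW : Module.finrank ℝ W = m) {ν : W [⋀^Fin m]→L[ℝ] ℝ} (hν : ν ≠ 0) :
    ∃ b : Fin m → W, ν b ≠ 0 ∧ ∀ μ : W [⋀^Fin m]→L[ℝ] ℝ, μ = (μ b / ν b) • ν := by
  let b := Module.finBasisOfFinrankEq ℝ W hW
  have h : ∀ μ : W [⋀^Fin m]→L[ℝ] ℝ, ∀ a, μ a = μ b * b.det a := fun μ a =>
    DFunLike.congr_fun (μ.toAlternatingMap.eq_smul_basis_det b) a
  have hb : ν b ≠ 0 := fun h0 => hν (by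
    ext a
    simp [h ν a, h0])
  refine ⟨b, hb, fun μ => ?_⟩
  ext a
  change μ a = (μ b / ν b) * ν a
  rw [h μ a, h ν a]
  field_simp

/-- Contraction with a covector is an antiderivation, so it vanishes on a product of vectors that
the covector kills. -/
theorem contractLeft_ιMulti_eq_zero {V : Type*} [AddCommGroup V] [Module ℝ V] (d : Module.Dual ℝ V)
    {m : ℕ} (Y : Fin m → V) (hY : ∀ i, d (Y i) = 0) :
    CliffordAlgebra.contractLeft (Q := (0 : QuadraticForm ℝ V)) d
      (ExteriorAlgebra.ιMulti ℝ m Y : ExteriorAlgebra ℝ V) = 0 := by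
  induction m with
  | zero =>
    rw [ExteriorAlgebra.ιMulti_zero_apply]
    exact CliffordAlgebra.contractLeft_one 0 d
  | succ m ih =>
    rw [ExteriorAlgebra.ιMulti_succ_apply]
    refine (CliffordAlgebra.contractLeft_ι_mul d _ _).trans ?_
    rw [hY 0, zero_smul, zero_sub, neg_eq_zero]
    refine (congrArg _ (ih (Matrix.vecTail Y) fun i => hY i.succ)).trans (mul_zero _)

theorem mvContract_ιMulti {V : Type*} [AddCommGroup V] [Module ℝ V] [TopologicalSpace V] {m : ℕ}
    (Y : Fin m → V) (Ω : V [⋀^Fin (m + 1)]→L[ℝ] ℝ) (w : V) :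
    mvContract (exteriorPower.ιMulti ℝ m Y) Ω w = (-1 : ℝ) ^ m * Ω (Fin.cons w Y) := by
  change (-1 : ℝ) ^ m * exteriorPower.alternatingMapLinearEquiv
    (Ω.toAlternatingMap.curryLeft w) (exteriorPower.ιMulti ℝ m Y) = _
  rw [exteriorPower.alternatingMapLinearEquiv_apply_ιMulti]
  rfl

theorem map_cons_eq_zero_of_mvContract_eq_zero {V : Type*} [AddCommGroup V] [Module ℝ V]
    [TopologicalSpace V] {m : ℕ} {X : ⋀[ℝ]^m V} {Y : Fin m → V}
    (hX : X = exteriorPower.ιMulti ℝ m Y) {Ω : V [⋀^Fin (m + 1)]→L[ℝ] ℝ}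
    (h : mvContract X Ω = 0) (w : V) : Ω (Fin.cons w Y) = 0 := by
  have h1 := DFunLike.congr_fun h w
  rw [hX, mvContract_ιMulti] at h1
  exact (mul_eq_zero.1 h1).resolve_left (pow_ne_zero m (by norm_num))

theorem contractLeft_comp_flip_eq_zero {V D : Type*} [AddCommGroup V] [Module ℝ V]
    [AddCommGroup D] [Module ℝ D] {m : ℕ} {X : ⋀[ℝ]^m V} {Y : Fin m → V}
    (hX : X = exteriorPower.ιMulti ℝ m Y) (e : V →ₗ[ℝ] D →ₗ[ℝ] V) (hY : ∀ i, e (Y i) = 0) (β : D)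
    (ζ : Module.Dual ℝ V) :
    CliffordAlgebra.contractLeft (Q := (0 : QuadraticForm ℝ V)) (ζ ∘ₗ e.flip β)
      (X : ExteriorAlgebra ℝ V) = 0 := by
  subst hX
  exact contractLeft_ιMulti_eq_zero _ Y fun i => by simp [hY]

theorem mvPair_eq {V : Type*} [AddCommGroup V] [Module ℝ V] [TopologicalSpace V] {m : ℕ}
    {X : ⋀[ℝ]^m V} {Y : Fin m → V} (hX : X = exteriorPower.ιMulti ℝ m Y)
    (α : V [⋀^Fin m]→L[ℝ] ℝ) : mvPair X α = α Y := by
  subst hX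
  exact exteriorPower.alternatingMapLinearEquiv_apply_ιMulti _ _

/-! ### The volume form in a fibred chart -/

namespace SmoothFibreBundle

variable {m n : ℕ} {M F E : Type*}
  [TopologicalSpace M] [ChartedSpace (Eu m) M] [IsManifold (𝓡 m) ∞ M]
  [TopologicalSpace F] [ChartedSpace (Eu n) F] [IsManifold (𝓡 n) ∞ F]
  [TopologicalSpace E] [ChartedSpace (Eu (m + n)) E] [IsManifold (𝓡 (m + n)) ∞ E]
  {B : SmoothFibreBundle m n M F E}

/-- The coordinate expression of a form on the base in a fibred chart. -/
def volCoord (c : B.FibredChart) (η : (x : M) → TangentSpace (𝓡 m) x [⋀^Fin m]→L[ℝ] ℝ) (u : Eu m) :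
    Eu m [⋀^Fin m]→L[ℝ] ℝ :=
  (η (c.base.symm u)).compContinuousLinearMap (c.dbaseSymm u)

/-- Smoothness of `η` is given in the preferred charts of `M`, of which the base of a fibred chart
need not be one. Near `u` the expression is the pullback of the preferred one by the smooth change
of coordinates. -/
theorem differentiableAt_volCoord (c : B.FibredChart)
    {η : (x : M) → TangentSpace (𝓡 m) x [⋀^Fin m]→L[ℝ] ℝ} (hη : IsSmoothForm η) {u : Eu m}
    (hu : u ∈ c.base.target) : DifferentiableAt ℝ (volCoord c η) u := by
  set φ := chartAt (Eu m) (c.base.symm u) with hφ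
  have hφm : φ.MDifferentiable (𝓡 m) (𝓡 m) := mdifferentiable_chart _
  set S := (c.base.symm.trans φ).source with hS
  have hSo : IsOpen S := (c.base.symm.trans φ).open_source
  have hSm : ∀ x ∈ S, x ∈ c.base.target ∧ c.base.symm x ∈ φ.source := fun x hx => by
    rw [hS, OpenPartialHomeomorph.trans_source] at hx
    exact hx
  have huS : u ∈ S := by
    rw [hS, OpenPartialHomeomorph.trans_source]
    exact ⟨hu, mem_chart_source _ _⟩
  have hg : ContDiffOn ℝ ∞ (φ ∘ c.base.symm) S := by
    rw [← contMDiffOn_iff_contDiffOn]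
    exact (contMDiffOn_chart (I := 𝓡 m) (n := ∞)).comp
      (c.base_symm_smooth.mono fun z hz => (hSm z hz).1) fun z hz => (hSm z hz).2
  have hgu : ContDiffAt ℝ ∞ (φ ∘ c.base.symm) u := hg.contDiffAt (hSo.mem_nhds huS)
  have hα : DifferentiableAt ℝ (chartForm η (c.base.symm u)) ((φ ∘ c.base.symm) u) :=
    ((hη (c.base.symm u)).contDiffAt
      (φ.open_target.mem_nhds (φ.map_source (mem_chart_source _ _)))).differentiableAt (by simp)
  have h1 : DifferentiableAt ℝ (fun x => chartForm η (c.base.symm u) ((φ ∘ c.base.symm) x)) u :=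
    hα.comp u (hgu.differentiableAt (by simp))
  have h2 : DifferentiableAt ℝ (fderiv ℝ (φ ∘ c.base.symm)) u :=
    (hgu.fderiv_right (m := ∞) (by simp)).differentiableAt (by simp)
  refine (h1.continuousAlternatingMapCompContinuousLinearMap h2).congr_of_eventuallyEq ?_
  filter_upwards [hSo.mem_nhds huS] with x hx
  have hx' := hSm x hx
  have e1 : φ.symm ((φ ∘ c.base.symm) x) = c.base.symm x := φ.left_inv hx'.2
  have e2 : HasMFDerivAt (𝓡 m) (𝓡 m) (φ ∘ c.base.symm) x (fderiv ℝ (φ ∘ c.base.symm) x) :=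
    ((hg.contDiffAt (hSo.mem_nhds hx)).differentiableAt (by simp)).hasFDerivAt.hasMFDerivAt
  have e3 := HasMFDerivAt.comp x
    (hφm.mdifferentiableAt_symm (φ.map_source hx'.2)).hasMFDerivAt e2
  have e4 : (φ.symm ∘ φ ∘ c.base.symm) =ᶠ[𝓝 x] c.base.symm := by
    filter_upwards [hSo.mem_nhds hx] with z hz
    exact φ.left_inv (hSm z hz).2
  have e5 := (c.base_mdiff.mdifferentiableAt_symm hx'.1).hasMFDerivAt.congr_of_eventuallyEq e4
  have e6 := hasMFDerivAt_unique e5 e3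
  have e7 : (η (φ.symm ((φ ∘ c.base.symm) x)) : Eu m [⋀^Fin m]→L[ℝ] ℝ) = η (c.base.symm x) :=
    congrArg (show M → Eu m [⋀^Fin m]→L[ℝ] ℝ from η) e1
  ext a
  have e8 : ∀ b : Eu m, c.dbaseSymm x b =
      (mfderiv (𝓡 m) (𝓡 m) φ.symm ((φ ∘ c.base.symm) x) : Eu m →L[ℝ] Eu m)
        (fderiv ℝ (φ ∘ c.base.symm) x b) := fun b => DFunLike.congr_fun e6 b
  change (η (c.base.symm x) : Eu m [⋀^Fin m]→L[ℝ] ℝ) (fun i => c.dbaseSymm x (a i)) =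
    (η (φ.symm ((φ ∘ c.base.symm) x)) : Eu m [⋀^Fin m]→L[ℝ] ℝ) _
  rw [e7]
  exact congrArg _ (funext fun i => e8 (a i))

theorem volCoord_ne_zero (c : B.FibredChart)
    {η : (x : M) → TangentSpace (𝓡 m) x [⋀^Fin m]→L[ℝ] ℝ} (hη0 : ∀ x, η x ≠ 0) {u : Eu m}
    (hu : u ∈ c.base.target) : volCoord c η u ≠ 0 := by
  intro h
  refine hη0 (c.base.symm u) ?_
  have h1 := DFunLike.congr_fun (c.dbaseSymm_dbase (c.base.map_target hu))
  rw [c.base.right_inv hu] at h1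
  ext a
  have h2 := DFunLike.congr_fun h fun i => c.dbase (c.base.symm u) (a i)
  change η (c.base.symm u) (fun i => c.dbaseSymm u (c.dbase (c.base.symm u) (a i))) = 0 at h2
  exact (congrArg (η (c.base.symm u)) (funext fun i => (h1 (a i)).symm)).trans h2

/-! ### The Poincaré–Cartan form and the Hessian in natural charts -/

namespace J1

variable {j₀ : B.J1} {w : J1Model m n}

/-- Both tensors inserted into `η` take the form `dbaseSymm` after a coordinate expression, so
`dbaseSymm` comes out of every slot and turns `η` into `volCoord`. -/
theorem chartForm_thetaL (η : (x : M) → TangentSpace (𝓡 m) x [⋀^Fin m]→L[ℝ] ℝ) {L : B.J1 → ℝ}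
    (hL : ContMDiff 𝓘(ℝ, J1Model m n) 𝓘(ℝ, ℝ) ∞ L)
    (hw : w ∈ (chartAt (J1Model m n) j₀).target) :
    chartForm (thetaL η L) j₀ w =
      tensorContract (momentum (coordFun j₀ L) w) (baseProj _ _) (volCoord j₀.fibredChart η w.1) +
      coordFun j₀ L w •
        (volCoord j₀.fibredChart η w.1).compContinuousLinearMap (baseProj _ _) := by
  have e : B.proj ((chartAt (J1Model m n) j₀).symm w).pt = j₀.fibredChart.base.symm w.1 := by
    rw [chartAt_symm_pt hw, j₀.fibredChart.base_symm_fst (mem_chartAt_target.1 hw)]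
  have e1 : (η (B.proj ((chartAt (J1Model m n) j₀).symm w).pt) : Eu m [⋀^Fin m]→L[ℝ] ℝ) =
      η (j₀.fibredChart.base.symm w.1) :=
    congrArg (show M → Eu m [⋀^Fin m]→L[ℝ] ℝ from η) e
  ext Z
  change ∑ i, (η (B.proj ((chartAt (J1Model m n) j₀).symm w).pt) : Eu m [⋀^Fin m]→L[ℝ] ℝ)
      (Function.update (fun i => J1.dbar _ (dsymm j₀ w (Z i))) i
        (J1.vertEndoContract _ L (dsymm j₀ w (Z i)))) +
      coordFun j₀ L w * (η (B.proj ((chartAt (J1Model m n) j₀).symm w).pt) :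
        Eu m [⋀^Fin m]→L[ℝ] ℝ) (fun i => J1.dbar _ (dsymm j₀ w (Z i))) =
    ∑ i, (η (j₀.fibredChart.base.symm w.1) : Eu m [⋀^Fin m]→L[ℝ] ℝ)
      (fun k => j₀.fibredChart.dbaseSymm w.1 (Function.update (fun i => baseProj _ _ (Z i)) i
        (momentum (coordFun j₀ L) w (Z i)) k)) +
      coordFun j₀ L w * (η (j₀.fibredChart.base.symm w.1) : Eu m [⋀^Fin m]→L[ℝ] ℝ)
        (fun i => j₀.fibredChart.dbaseSymm w.1 (baseProj _ _ (Z i)))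
  simp only [e1, dbar_dsymm hw, vertEndoContract_dsymm hw hL]
  refine congrArg₂ _ (Finset.sum_congr rfl fun i _ => congrArg _ (funext fun k => ?_)) rfl
  rcases eq_or_ne k i with rfl | h
  · exact (Function.update_self (β := fun _ => Eu m) k _ _).trans
      (congrArg _ (Function.update_self (β := fun _ => Eu m) k _ _).symm)
  · exact (Function.update_of_ne (β := fun _ => Eu m) h _ _).trans
      (congrArg _ (Function.update_of_ne (β := fun _ => Eu m) h _
        (fun i => baseProj _ _ (Z i))).symm)

/-- In natural coordinates, `Θ_ℒ` is a Poincaré–Cartan form. -/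
theorem exists_chartForm_thetaL_eq {η : (x : M) → TangentSpace (𝓡 m) x [⋀^Fin m]→L[ℝ] ℝ}
    (hη : IsSmoothForm η) (hη0 : ∀ x, η x ≠ 0) {L : B.J1 → ℝ}
    (hL : ContMDiff 𝓘(ℝ, J1Model m n) 𝓘(ℝ, ℝ) ∞ L)
    (hw : w ∈ (chartAt (J1Model m n) j₀).target) :
    ∃ f : Eu m → ℝ, DifferentiableAt ℝ f w.1 ∧ f w.1 = 1 ∧ chartForm (thetaL η L) j₀ =ᶠ[𝓝 w]
      coordTheta f (volCoord j₀.fibredChart η w.1) (coordFun j₀ L) := by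
  obtain ⟨b, hb, h⟩ := exists_eq_smul_form (by simp)
    (volCoord_ne_zero j₀.fibredChart hη0 (base_symm_mem hw))
  -- Top-degree forms are proportional, so `f` is the ratio of the volume form at `u` to that at
  -- `w.1`, measured on the frame `b`.
  refine ⟨fun u => volCoord j₀.fibredChart η u b / volCoord j₀.fibredChart η w.1 b, ?_,
    div_self hb, ?_⟩
  · have hd : DifferentiableAt ℝ (fun u => volCoord j₀.fibredChart η u b) w.1 :=
      (differentiableAt_volCoord j₀.fibredChart hη
        (base_symm_mem hw)).continuousAlternatingMap_apply_const b
    simpa only [div_eq_mul_inv] using hd.mul_const _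
  · filter_upwards [(chartAt (J1Model m n) j₀).open_target.mem_nhds hw] with z hz
    rw [chartForm_thetaL η hL hz]
    ext Z
    have hz' : ∀ a, volCoord j₀.fibredChart η z.1 a =
        volCoord j₀.fibredChart η z.1 b / volCoord j₀.fibredChart η w.1 b *
          volCoord j₀.fibredChart η w.1 a :=
      fun a => DFunLike.congr_fun (h (volCoord j₀.fibredChart η z.1)) a
    change ∑ i, volCoord j₀.fibredChart η z.1 (Function.update (fun i => baseProj _ _ (Z i)) i
        (momentum (coordFun j₀ L) z (Z i))) +
        coordFun j₀ L z * volCoord j₀.fibredChart η z.1 (fun i => baseProj _ _ (Z i)) =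
      (volCoord j₀.fibredChart η z.1 b / volCoord j₀.fibredChart η w.1 b) *
        (∑ i, volCoord j₀.fibredChart η w.1 (Function.update (fun i => baseProj _ _ (Z i)) i
          (momentum (coordFun j₀ L) z (Z i))) +
        coordFun j₀ L z * volCoord j₀.fibredChart η w.1 (fun i => baseProj _ _ (Z i)))
    rw [mul_add, Finset.mul_sum, hz' (fun i => baseProj _ _ (Z i)), mul_left_comm]
    exact congrArg₂ _ (Finset.sum_congr rfl fun i _ => hz' _) rfl

theorem contDiffAt_coordFun {L : B.J1 → ℝ} (hL : ContMDiff 𝓘(ℝ, J1Model m n) 𝓘(ℝ, ℝ) ∞ L)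
    (hw : w ∈ (chartAt (J1Model m n) j₀).target) : ContDiffAt ℝ 2 (coordFun j₀ L) w :=
  ((contDiffOn_coordFun j₀ hL).contDiffAt
    ((chartAt (J1Model m n) j₀).open_target.mem_nhds hw)).of_le ENat.LEInfty.out

theorem fibreHessian_eq (j : B.J1) {L : B.J1 → ℝ} (hL : ContMDiff 𝓘(ℝ, J1Model m n) 𝓘(ℝ, ℝ) ∞ L)
    (k₁ k₂ : j.VHom) :
    fibreHessian L j k₁ k₂ =
      fderiv ℝ (fderiv ℝ (coordFun j L)) (chartAt (J1Model m n) j j)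
        (vertIncl _ _ (vertCoord j.fibredChart j k₁))
        (vertIncl _ _ (vertCoord j.fibredChart j k₂)) := by
  rw [← deriv_deriv_eq_fderiv_fderiv (contDiffAt_coordFun hL (mem_chart_target _ j))]
  refine congrArg (fun g : ℝ → ℝ => deriv g 0) (funext fun s => ?_)
  refine congrArg (fun g : ℝ → ℝ => deriv g 0) (funext fun t => ?_)
  rw [addVert_eq j j (mem_chart_source _ j)]
  simp only [map_add, map_smul]
  rfl

/-- Needed to pass from the intrinsic Hessian to all coordinate directions. The preimage of `κ` is
vertical because `(0, κ)` has no base component. -/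
theorem vertCoord_surjective (c : B.FibredChart) {j : B.J1} (hj : j.pt ∈ c.total.source) :
    Function.Surjective (vertCoord c j) := by
  intro κ
  have hx := c.proj_mem _ hj
  have h1 := fun b => DFunLike.congr_fun (c.dbaseSymm_dbase hx) b
  have h2 := fun b => DFunLike.congr_fun (c.dbase_dproj hj) b
  have h3 := fun b => DFunLike.congr_fun (c.dtotal_dtotalSymm (c.total.map_source hj)) b
  have h4 := fun b => DFunLike.congr_fun (c.dbase_dbaseSymm (c.base.map_source hx)) b
  rw [c.total.left_inv hj] at h3
  rw [c.base.left_inv hx] at h4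
  simp only [ContinuousLinearMap.comp_apply, ContinuousLinearMap.id_apply,
    ContinuousLinearMap.coe_fst'] at h1 h2 h3 h4
  refine ⟨⟨((c.dtotalSymm (c.total j.pt)).comp
    ((ContinuousLinearMap.inr ℝ (Eu m) (Eu n)).comp κ)).comp (c.dbase (B.proj j.pt)), ?_⟩, ?_⟩
  · change (B.dproj j.pt).comp _ = 0
    ext1 a
    simp only [ContinuousLinearMap.comp_apply, ContinuousLinearMap.inr_apply]
    rw [← h1 (B.dproj j.pt _), h2, h3]
    exact map_zero _
  · ext1 a
    rw [vertCoord_apply]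
    simp only [ContinuousLinearMap.comp_apply, ContinuousLinearMap.inr_apply, h3]
    rw [← c.base_proj _ hj, h4]

/-! ### Evaluation in the preferred chart at its own base point -/

/-- The tangent map of the preferred chart at `j`, at `j`. -/
def dchart (j : B.J1) : TangentSpace 𝓘(ℝ, J1Model m n) j →L[ℝ] J1Model m n :=
  mfderiv 𝓘(ℝ, J1Model m n) 𝓘(ℝ, J1Model m n) (chartAt (J1Model m n) j) j

theorem dchart_bijective (j : B.J1) : Function.Bijective (dchart j) :=
  (chartAt_mdiff j).mfderiv_bijective (mem_chart_source _ j)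

theorem dsymm_dchart (j : B.J1) (Y : TangentSpace 𝓘(ℝ, J1Model m n) j) :
    (dsymm j (chartAt (J1Model m n) j j) (dchart j Y) : J1Model m n) = Y :=
  DFunLike.congr_fun ((chartAt_mdiff j).symm_comp_deriv (mem_chart_source _ j)) Y

theorem dbar_eq (j : B.J1) (Y : TangentSpace 𝓘(ℝ, J1Model m n) j) :
    j.dbar Y = j.fibredChart.dbaseSymm (chartAt (J1Model m n) j j).1
      (baseProj _ _ (dchart j Y)) := by
  -- Stated for every `i` equal to the image of the coordinates of `j`, so that the base point can
  -- be exchanged for `j` itself.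
  have h : ∀ (i : B.J1), i = (chartAt (J1Model m n) j).symm (chartAt (J1Model m n) j j) →
      J1.dbar i (dsymm j (chartAt (J1Model m n) j j) (dchart j Y) : J1Model m n) =
        j.fibredChart.dbaseSymm (chartAt (J1Model m n) j j).1 (baseProj _ _ (dchart j Y)) := by
    rintro _ rfl
    exact dbar_dsymm (mem_chart_target _ j) _
  have h1 := h j ((chartAt (J1Model m n) j).left_inv (mem_chart_source _ j)).symm
  rwa [dsymm_dchart] at h1

theorem structureForm_eq (j : B.J1) (Y : TangentSpace 𝓘(ℝ, J1Model m n) j) :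
    j.structureForm Y = j.fibredChart.dtotalSymm (j.fibredChart.total j.pt)
      (0, contactForm (j.fibredChart.velocity j) (dchart j Y)) := by
  have h : ∀ (i : B.J1), i = (chartAt (J1Model m n) j).symm (chartAt (J1Model m n) j j) →
      J1.structureForm i (dsymm j (chartAt (J1Model m n) j j) (dchart j Y) : J1Model m n) =
        j.fibredChart.dtotalSymm (j.fibredChart.total j.pt)
          (0, contactForm (j.fibredChart.velocity j) (dchart j Y)) := by
    rintro _ rfl
    exact structureForm_dsymm (mem_chart_target _ j) _
  have h1 := h j ((chartAt (J1Model m n) j).left_inv (mem_chart_source _ j)).symm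
  rwa [dsymm_dchart] at h1

/-- The vertical endomorphism depends on `Y` only through the structure form, which is the contact
form in coordinates. -/
theorem vertEndo_eq_zero (j : B.J1) {Y : TangentSpace 𝓘(ℝ, J1Model m n) j}
    (h : contactForm (j.fibredChart.velocity j) (dchart j Y) = 0) : j.vertEndo Y = 0 := by
  have h1 : j.structureForm Y = 0 := by
    rw [structureForm_eq, h]
    exact map_zero _
  ext1 β
  have h2 : j.tensorVert Y β = 0 := by
    apply Subtype.ext
    ext1 a
    change β a • j.structureForm Y = 0
    rw [h1, smul_zero]
  change j.vertLift (j.tensorVert Y β) = 0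
  rw [h2]
  exact map_zero _

theorem volPullback_eq (j : B.J1) (η : (x : M) → TangentSpace (𝓡 m) x [⋀^Fin m]→L[ℝ] ℝ)
    (Y : Fin m → TangentSpace 𝓘(ℝ, J1Model m n) j) :
    volPullback η j Y = volCoord j.fibredChart η (chartAt (J1Model m n) j j).1
      fun i => baseProj _ _ (dchart j (Y i)) := by
  have hj := j.mem_fibredChart_source
  have e : B.proj j.pt = j.fibredChart.base.symm (chartAt (J1Model m n) j j).1 := by
    rw [chartAt_apply, ← j.fibredChart.base_proj _ hj,
      j.fibredChart.base.left_inv (j.fibredChart.proj_mem _ hj)]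
  have e1 : (η (B.proj j.pt) : Eu m [⋀^Fin m]→L[ℝ] ℝ) =
      η (j.fibredChart.base.symm (chartAt (J1Model m n) j j).1) :=
    congrArg (show M → Eu m [⋀^Fin m]→L[ℝ] ℝ from η) e
  change (η (B.proj j.pt) : Eu m [⋀^Fin m]→L[ℝ] ℝ) (fun i => j.dbar (Y i)) = _
  rw [e1]
  exact congrArg _ (funext fun i => dbar_eq j (Y i))

/-! ### Regularity and semi-holonomy -/

/-- `Ω_ℒ` in natural coordinates. -/
theorem exists_omegaL_eq {η : (x : M) → TangentSpace (𝓡 m) x [⋀^Fin m]→L[ℝ] ℝ}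
    (hη : IsSmoothForm η) (hη0 : ∀ x, η x ≠ 0) {L : B.J1 → ℝ}
    (hL : ContMDiff 𝓘(ℝ, J1Model m n) 𝓘(ℝ, ℝ) ∞ L) (j : B.J1) :
    ∃ f : Eu m → ℝ, DifferentiableAt ℝ f (chartAt (J1Model m n) j j).1 ∧
      f (chartAt (J1Model m n) j j).1 = 1 ∧
      ∀ (W : TangentSpace 𝓘(ℝ, J1Model m n) j) (Y : Fin m → TangentSpace 𝓘(ℝ, J1Model m n) j),
        omegaL η L j (Fin.cons W Y) =
          -extDeriv (coordTheta f (volCoord j.fibredChart η (chartAt (J1Model m n) j j).1)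
            (coordFun j L)) (chartAt (J1Model m n) j j)
            (Fin.cons (dchart j W) fun i => dchart j (Y i)) := by
  obtain ⟨f, hf, hf1, h⟩ := exists_chartForm_thetaL_eq hη hη0 hL (mem_chart_target _ j)
  refine ⟨f, hf, hf1, fun W Y => ?_⟩
  rw [← h.extDeriv_eq]
  change -(extDeriv (chartForm (thetaL η L) j) (chartAt (J1Model m n) j j)
    fun i => dchart j ((Fin.cons W Y : Fin (m + 1) → TangentSpace 𝓘(ℝ, J1Model m n) j) i)) = _
  refine congrArg Neg.neg (congrArg _ (funext fun i => ?_))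
  cases i using Fin.cases <;> rfl

/-- Regularity of the Lagrangian system gives a nonsingular Hessian in natural coordinates. -/
theorem hessian_nonsingular {η : (x : M) → TangentSpace (𝓡 m) x [⋀^Fin m]→L[ℝ] ℝ}
    (hη : IsSmoothForm η) (hη0 : ∀ x, η x ≠ 0) {L : B.J1 → ℝ}
    (hL : ContMDiff 𝓘(ℝ, J1Model m n) 𝓘(ℝ, ℝ) ∞ L) (hreg : IsRegularLagrangian η L) (j : B.J1)
    (κ : Eu m →L[ℝ] Eu n)
    (hκ : ∀ κ', fderiv ℝ (fderiv ℝ (coordFun j L)) (chartAt (J1Model m n) j j)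
      (vertIncl _ _ κ) (vertIncl _ _ κ') = 0) : κ = 0 := by
  rcases hreg with h | h
  -- Nondegenerate case: a `κ` in the kernel of the Hessian is the image of a vector `W` with `i(W)Ω
  -- = 0`.
  · obtain ⟨f, hf, -, hΩ⟩ := exists_omegaL_eq hη hη0 hL j
    obtain ⟨W, hW⟩ := (dchart_bijective j).2 (vertIncl _ _ κ)
    have hW0 : W = 0 := by
      refine h j W fun Y => ?_
      rw [hΩ, hW, extDeriv_coordTheta_cons_eq_zero (by simp) hf
        (contDiffAt_coordFun hL (mem_chart_target _ j)) κ hκ, neg_zero]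
    have h0 : vertIncl (Eu m) (Eu n) κ = 0 := by
      rw [← hW, hW0]
      exact map_zero _
    exact congrArg (fun w : J1Model m n => w.2.2) h0
  -- Hessian case: `κ` consists of the coordinates of an intrinsic fibre direction `k`, to which the
  -- hypothesis applies.
  · obtain ⟨k, rfl⟩ := vertCoord_surjective j.fibredChart j.mem_fibredChart_source κ
    rw [h j k fun k₂ => (fibreHessian_eq j hL k k₂).trans (hκ _), map_zero]

/-- The tangent map of the chart is bijective, so every coordinate vertical direction may be
inserted into `Ω_ℒ`, which reduces the claim to `contactForm_eq_zero`. -/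
theorem contactForm_dchart_eq_zero {η : (x : M) → TangentSpace (𝓡 m) x [⋀^Fin m]→L[ℝ] ℝ}
    (hη : IsSmoothForm η) (hη0 : ∀ x, η x ≠ 0) {L : B.J1 → ℝ}
    (hL : ContMDiff 𝓘(ℝ, J1Model m n) 𝓘(ℝ, ℝ) ∞ L) (hreg : IsRegularLagrangian η L) (j : B.J1)
    (Y : Fin m → TangentSpace 𝓘(ℝ, J1Model m n) j) (hω : volPullback η j Y ≠ 0)
    (hYΩ : ∀ W, omegaL η L j (Fin.cons W Y) = 0) (i : Fin m) :
    contactForm (j.fibredChart.velocity j) (dchart j (Y i)) = 0 := by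
  obtain ⟨f, hf, hf1, hΩ⟩ := exists_omegaL_eq hη hη0 hL j
  rw [volPullback_eq] at hω
  have hd : ∀ κ, extDeriv (coordTheta f (volCoord j.fibredChart η (chartAt (J1Model m n) j j).1)
      (coordFun j L)) (chartAt (J1Model m n) j j)
      (Fin.cons (vertIncl _ _ κ) fun i => dchart j (Y i)) = 0 := fun κ => by
    obtain ⟨W, hW⟩ := (dchart_bijective j).2 (vertIncl _ _ κ)
    have h1 := (hΩ W Y).symm.trans (hYΩ W)
    rw [hW] at h1
    exact neg_eq_zero.1 h1
  exact contactForm_eq_zero (by simp) hf (contDiffAt_coordFun hL (mem_chart_target _ j))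
    (hessian_nonsingular hη hη0 hL hreg j) (by rw [hf1]; exact one_ne_zero)
    (fun i => dchart j (Y i)) hω hd i

end J1

theorem isSemiHolonomic_of_contract_eq_zero
    {η : (x : M) → TangentSpace (𝓡 m) x [⋀^Fin m]→L[ℝ] ℝ}
    (hη : IsSmoothForm η) (hη0 : ∀ x, η x ≠ 0) {L : B.J1 → ℝ}
    (hL : ContMDiff 𝓘(ℝ, J1Model m n) 𝓘(ℝ, ℝ) ∞ L) (hreg : IsRegularLagrangian η L)
    {X : (j : B.J1) → ⋀[ℝ]^m (TangentSpace 𝓘(ℝ, J1Model m n) j)} (hX : IsLocallyDecomposable X)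
    (hXω : ∀ j, mvPair (X j) (volPullback η j) = 1)
    (hXΩ : ∀ j, mvContract (X j) (omegaL η L j) = 0) : IsSemiHolonomic X := by
  intro j β ζ
  obtain ⟨U, -, hjU, Y', -, hY'⟩ := hX j
  -- From here on the argument takes place in the single tangent space at `j`.
  obtain ⟨Y, hY⟩ : ∃ Y : Fin m → TangentSpace 𝓘(ℝ, J1Model m n) j,
    X j = exteriorPower.ιMulti ℝ m Y := ⟨_, hY' j hjU⟩
  have hω : volPullback η j Y = 1 := (mvPair_eq hY _).symm.trans (hXω j)
  have h : ∀ i, j.vertEndo (Y i) = 0 := fun i =>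
    J1.vertEndo_eq_zero j (J1.contactForm_dchart_eq_zero hη hη0 hL hreg j Y
      (hω.trans_ne one_ne_zero) (map_cons_eq_zero_of_mvContract_eq_zero hY (hXΩ j)) i)
  exact contractLeft_comp_flip_eq_zero hY j.vertEndo h β ζ

end SmoothFibreBundle

end

theorem mainTheorem7 {m n : ℕ} {M F E : Type*}
    [TopologicalSpace M] [ChartedSpace (Eu m) M] [IsManifold (𝓡 m) ∞ M]
    [TopologicalSpace F] [ChartedSpace (Eu n) F] [IsManifold (𝓡 n) ∞ F]
    [TopologicalSpace E] [ChartedSpace (Eu (m + n)) E] [IsManifold (𝓡 (m + n)) ∞ E]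
    (B : SmoothFibreBundle m n M F E)
    (η : (x : M) → TangentSpace (𝓡 m) x [⋀^Fin m]→L[ℝ] ℝ)
    (hη : IsSmoothForm η) (hη0 : ∀ x, η x ≠ 0)
    (L : B.J1 → ℝ) (hL : ContMDiff 𝓘(ℝ, SmoothFibreBundle.J1Model m n) 𝓘(ℝ, ℝ) ∞ L)
    (hreg : SmoothFibreBundle.IsRegularLagrangian η L)
    (X : (j : B.J1) → ⋀[ℝ]^m (TangentSpace 𝓘(ℝ, SmoothFibreBundle.J1Model m n) j))
    (hX : IsLocallyDecomposable X)
    (hXω : ∀ j, mvPair (X j) (SmoothFibreBundle.volPullback η j) = 1)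
    (hXΩ : ∀ j, mvContract (X j) (SmoothFibreBundle.omegaL η L j) = 0) :
    SmoothFibreBundle.IsSemiHolonomic X ∧ SmoothFibreBundle.IsEulerLagrange η L X := by
  have h := SmoothFibreBundle.isSemiHolonomic_of_contract_eq_zero hη hη0 hL hreg hX hXω hXΩ
  exact ⟨h, hX, h, hXΩ⟩
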